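/- All groups are finite. A complex projective representation of a group $G$ of degree $d\ge 1$ is a map $\rho:G\to \mathrm{GL}_d(\mathbb C)$ with $\rho(1)=I$ such that for all $g,h\in G$ one has $\rho(g)\rho(h)=\alpha(g,h)\rho(gh)$ for some $\alpha(g,h)\in\mathbb C^\times$. It is faithful if $1$ is the only element $g \in G$ for which $\rho(g)$ is a scalar matrix, and irreducible if the only subspaces of $\mathbb C^d$ stable under all $\rho(g)$ are $0$ and $\mathbb C^d$. Let $\tau(G)$ be the least degree of a faithful complex projective representation of $G$ (equivalently, the least $d\ge 1$ such that $G$ embeds into $\mathrm{PGL}_d(\mathbb C)$), and let $\tau_{\mathrm{irr}}(G)$ be the least degree of a faithful irreducible complex projective representation of $G$, which is said to exist if $G$ has such a representation. For $n\ge 1$ and $k\ge 0$ let $$H_{2n+1}(\mathbb Z/p^k\mathbb Z)=\langle x_i,y_i,z\ (1\le i\le n)\mid [x_i,y_i]=z,\ x_i^{p^k}=y_i^{p^k}=z^{p^k}=1\rangle ,$$ where all other pairs of generators commute; this is the Heisenberg group of triples $(a,b,c)$ with $a,b\in(\mathbb Z/p^k\mathbb Z)^n$, $c\in\mathbb Z/p^k\mathbb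 Z$ and product $(a,b,c)(a',b',c')=(a+a',\,b+b',\,c+c'+a\cdot b')$. Theorem. Let $p$ be an odd prime. (1) Let $G$ be a $p$-group such that $G'\subseteq Z(G)$ and $Z(G)$ is cyclic. If $\tau_{\mathrm{irr}}(G)$ exists, then $G\cong H_3(\mathbb Z/p^k\mathbb Z)$ for some integer $k\ge 0$ (where $k=0$ occurs only for the trivial group). Moreover, whenever $G\cong H_3(\mathbb Z/p^k\mathbb Z)$ with $k \ge 0$, $\tau_{\mathrm{irr}}(G)$ exists and $\tau_{\mathrm{irr}}(G)=\tau(G)=p^k$. (2) For all integers $n>1$ and $k\ge 1$, $\tau_{\mathrm{irr}}(H_{2n+1}(\mathbb Z/p^k\mathbb Z))$ does not exist, and $$\tau(H_{2n+1}(\mathbb Z/p^k\mathbb Z))\le p^{k\lfloor n/2\rfloor}+p^{k\lceil n/2\rceil}.$$ -/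

import Mathlib

/-- A complex projective representation of `G` on `V`: a map `ρ : G → GL(V)` with `ρ(1) = 1` and
`ρ(g) ρ(h) = α(g, h) ρ(gh)` for some `α : G × G → ℂˣ`. When `V ≠ 0`, associativity forces `α` to be
a 2-cocycle, and `ρ` is then an `α`-representation. -/
structure ProjRep (G : Type*) [Group G] (V : Type*) [AddCommGroup V] [Module ℂ V] where
  /-- the underlying map to `GL(V)` -/
  toFun : G → (V ≃ₗ[ℂ] V)
  /-- the cocycle `α` -/
  cocycle : G → G → ℂˣ
  map_one : ∀ v : V, toFun 1 v = v
  map_mul : ∀ (g h : G) (v : V), toFun g (toFun h v) = (cocycle g h : ℂ) • toFun (g * h) v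

namespace ProjRep

variable {G : Type*} [Group G] {V : Type*} [AddCommGroup V] [Module ℂ V]

/-- The kernel of a projective representation: the elements which act by a scalar. -/
def ker (ρ : ProjRep G V) : Set G :=
  {g | ∃ c : ℂˣ, ∀ v : V, ρ.toFun g v = (c : ℂ) • v}

/-- Faithfulness as a projective representation: only `1` acts by a scalar. -/
def IsFaithful (ρ : ProjRep G V) : Prop :=
  ρ.ker = {1}

/-- Irreducibility: `V ≠ 0`, and the only `G`-stable subspaces are `0` and `V`. -/
def IsIrreducible (ρ : ProjRep G V) : Prop :=
  Nontrivial V ∧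
    ∀ W : Submodule ℂ V, (∀ g : G, ∀ w ∈ W, ρ.toFun g w ∈ W) → W = ⊥ ∨ W = ⊤

end ProjRep

/-- The positive degrees of faithful complex projective representations of `G`. -/
def faithfulProjDegrees (G : Type*) [Group G] : Set ℕ :=
  {d | 0 < d ∧ ∃ ρ : ProjRep G (Fin d → ℂ), ρ.IsFaithful}

/-- The degrees of faithful irreducible complex projective representations of `G`. -/
def faithfulIrredProjDegrees (G : Type*) [Group G] : Set ℕ :=
  {d | 0 < d ∧ ∃ ρ : ProjRep G (Fin d → ℂ), ρ.IsFaithful ∧ ρ.IsIrreducible}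

/-- `τ(G)` exists and equals `d`. -/
def IsProjEmbeddingDegree (G : Type*) [Group G] (d : ℕ) : Prop :=
  IsLeast (faithfulProjDegrees G) d

/-- `τ_irr(G)` exists and equals `d`. -/
def IsIrredProjEmbeddingDegree (G : Type*) [Group G] (d : ℕ) : Prop :=
  IsLeast (faithfulIrredProjDegrees G) d

/-- The Heisenberg group `H_{2n+1}(R)`: triples `(a, b, c)` in `R^n × R^n × R`, standing for the
upper unitriangular matrix of size `n + 2` with first row `(1, a, c)`, last column `(c, b, 1)ᵀ` and
the identity in the middle block. For `R = ℤ/mℤ` and `n ≥ 1` the elements `x_i = (e_i, 0, 0)`,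
`y_i = (0, e_i, 0)`, `z = (0, 0, 1)` generate it, with defining relations
`x_i⁻¹ y_i⁻¹ x_i y_i = z`, `x_i^m = y_i^m = z^m = 1`, all other pairs of generators commuting. -/
@[ext]
structure Heisenberg (n : ℕ) (R : Type*) where
  a : Fin n → R
  b : Fin n → R
  c : R

namespace Heisenberg

variable {n : ℕ} {R : Type*} [CommRing R]

instance : One (Heisenberg n R) := ⟨⟨0, 0, 0⟩⟩

instance : Mul (Heisenberg n R) :=
  ⟨fun g h => ⟨g.a + h.a, g.b + h.b, g.c + h.c + g.a ⬝ᵥ h.b⟩⟩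

instance : Inv (Heisenberg n R) := ⟨fun g => ⟨-g.a, -g.b, -g.c + g.a ⬝ᵥ g.b⟩⟩

@[simp] theorem one_a : (1 : Heisenberg n R).a = 0 := rfl
@[simp] theorem one_b : (1 : Heisenberg n R).b = 0 := rfl
@[simp] theorem one_c : (1 : Heisenberg n R).c = 0 := rfl
@[simp] theorem mul_a (g h : Heisenberg n R) : (g * h).a = g.a + h.a := rfl
@[simp] theorem mul_b (g h : Heisenberg n R) : (g * h).b = g.b + h.b := rfl
@[simp] theorem mul_c (g h : Heisenberg n R) : (g * h).c = g.c + h.c + g.a ⬝ᵥ h.b := rfl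
@[simp] theorem inv_a (g : Heisenberg n R) : (g⁻¹).a = -g.a := rfl
@[simp] theorem inv_b (g : Heisenberg n R) : (g⁻¹).b = -g.b := rfl
@[simp] theorem inv_c (g : Heisenberg n R) : (g⁻¹).c = -g.c + g.a ⬝ᵥ g.b := rfl

instance : Group (Heisenberg n R) :=
  Group.ofLeftAxioms
    (fun g h k => by
      ext1
      · simp [add_assoc]
      · simp [add_assoc]
      · simp only [mul_a, mul_b, mul_c, add_dotProduct, dotProduct_add]
        ring)
    (fun g => by ext1 <;> simp)
    (fun g => by ext1 <;> simp)

end Heisenberg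

/-! Let `ρ` be faithful and irreducible, and let `Γ` be the group of pairs `(T, g)` with `T` a
scalar multiple of `ρ(g)`. By Schur's lemma and faithfulness the centre of `Γ` is exactly `ℂˣ`, and
`Γ/ℂˣ = G`. Lift a generator of `Z(G)`, of order `N`, to `u ∈ Γ`. Then `φ = [u, ·]` is a character
with values in the `N`-th roots of unity. If `φ(g)` generates its image, then `φ(g)` has order `N`,
because a power of `u` that is central in `Γ` must die in `G`.

The kernel of `φ` is commutative modulo scalars: a commutator of two of its elements lies over
`Z(G)` and commutes with `g` and with `ker φ`, so it is a scalar. A similar duality, applied to `[·,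
g]` on `ker φ`, yields `c ∈ ker φ` whose commutator with `g` generates `Z(G)`. Hence `c`, `g` and
`Z(G)` generate `G`, and the oddness of `N` gives `c ^ N = g ^ N = 1` in `G`. This is
`nonempty_mulEquiv_heisenberg_of_central_extension`; comparing orders, it also excludes `n > 1`.

Existence comes from two monomial representations, `ProjRep.quadratic` and `ProjRep.split`. The
lower bound `p ^ k` is `pow_le_finrank_of_orderOf_dvd`. Up to scalars, the operator `Z` of `z`
commutes with those of `x` and `y`. Let `A` be whichever of the latter two has a scalar of larger
order `r`, and `B` the other. Words in `A` and `B` applied to one joint eigenvector of `Z` and `A ^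
r` then produce `p ^ k` distinct pairs of eigenvalues. -/

/-! ### Commutation rules and recognition of the Heisenberg group. -/

theorem pow_mul_eq_of_mul_eq {G : Type*} [Group G] {a b t : G} (h : a * b = t * (b * a))
    (ht : Commute t a) (n : ℕ) : a ^ n * b = t ^ n * (b * a ^ n) := by
  induction n with
  | zero => simp
  | succ n ih =>
    calc a ^ (n + 1) * b = a * (a ^ n * b) := by rw [pow_succ', mul_assoc]
      _ = (a * t ^ n) * (b * a ^ n) := by rw [ih, mul_assoc]
      _ = t ^ n * (a * b) * a ^ n := by rw [← (ht.pow_left n).eq]; simp only [mul_assoc]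
      _ = t ^ (n + 1) * (b * a ^ (n + 1)) := by
        rw [h, pow_succ, pow_succ']; simp only [mul_assoc]

theorem mul_pow_eq_of_mul_eq {G : Type*} [Group G] {a b t : G} (h : a * b = t * (b * a))
    (ht : Commute t b) (n : ℕ) : a * b ^ n = t ^ n * (b ^ n * a) := by
  induction n with
  | zero => simp
  | succ n ih =>
    calc a * b ^ (n + 1) = (a * b ^ n) * b := by rw [pow_succ, mul_assoc]
      _ = t ^ n * b ^ n * (a * b) := by rw [ih]; simp only [mul_assoc]
      _ = t ^ n * (b ^ n * t) * (b * a) := by rw [h]; simp only [mul_assoc]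
      _ = t ^ (n + 1) * (b ^ (n + 1) * a) := by
        rw [← (ht.pow_right n).eq, pow_succ, pow_succ]; simp only [mul_assoc]

theorem pow_mul_pow_eq_of_mul_eq {G : Type*} [Group G] {x y z : G} (h : x * y = z * (y * x))
    (hx : Commute z x) (hy : Commute z y) (a b : ℕ) :
    x ^ a * y ^ b = z ^ (a * b) * (y ^ b * x ^ a) := by
  have h1 := mul_pow_eq_of_mul_eq h hy b
  rw [pow_mul_eq_of_mul_eq h1 (hx.pow_left b) a, ← pow_mul, mul_comm b a]

theorem pow_val_add {G : Type*} [Group G] {N : ℕ} [NeZero N] {x : G} (hx : x ^ N = 1)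
    (a b : ZMod N) : x ^ (a + b).val = x ^ a.val * x ^ b.val := by
  rw [← pow_add]
  refine pow_eq_pow_of_modEq ?_ hx
  rw [ZMod.val_add]
  exact Nat.mod_modEq _ _

theorem pow_val_mul {G : Type*} [Group G] {N : ℕ} [NeZero N] {x : G} (hx : x ^ N = 1)
    (a b : ZMod N) : x ^ (a * b).val = x ^ (a.val * b.val) := by
  refine pow_eq_pow_of_modEq ?_ hx
  rw [ZMod.val_mul]
  exact Nat.mod_modEq _ _

theorem pow_val_natCast {G : Type*} [Group G] {N : ℕ} [NeZero N] {x : G} (hx : x ^ N = 1)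
    (a : ℕ) : x ^ (a : ZMod N).val = x ^ a := by
  refine pow_eq_pow_of_modEq ?_ hx
  rw [ZMod.val_natCast]
  exact Nat.mod_modEq _ _

/-- A group generated by `x`, `y`, `z` subject to the Heisenberg relations, with `z = [x, y]` of
order exactly `N`, is the Heisenberg group over `ℤ/Nℤ`. -/
theorem nonempty_mulEquiv_heisenberg {G : Type*} [Group G] {N : ℕ} [NeZero N] {x y z : G}
    (hxy : x * y = z * (y * x)) (hzx : Commute z x) (hzy : Commute z y)
    (hx : x ^ N = 1) (hy : y ^ N = 1) (hz : orderOf z = N)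
    (hgen : ∀ g : G, ∃ a b c : ℕ, g = z ^ c * y ^ b * x ^ a) :
    Nonempty (G ≃* Heisenberg 1 (ZMod N)) := by
  have hzN : z ^ N = 1 := by rw [← hz]; exact pow_orderOf_eq_one z
  have hz0 : ∀ a : ZMod N, z ^ a.val = 1 → a = 0 := fun a ha => by
    have h1 := orderOf_dvd_of_pow_eq_one ha
    rw [hz] at h1
    rw [← ZMod.val_eq_zero]
    exact Nat.eq_zero_of_dvd_of_lt h1 a.val_lt
  let f : Heisenberg 1 (ZMod N) →* G := MonoidHom.mk'
    (fun g => z ^ (g.c).val * y ^ (g.b 0).val * x ^ (g.a 0).val) (fun g h => by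
      simp only [Heisenberg.mul_a, Heisenberg.mul_b, Heisenberg.mul_c, Pi.add_apply,
        dotProduct, Finset.univ_unique, Fin.default_eq_zero, Finset.sum_singleton]
      rw [pow_val_add hzN, pow_val_add hzN, pow_val_mul hzN, pow_val_add hx, pow_val_add hy]
      generalize (g.a 0).val = a
      generalize (g.b 0).val = b
      generalize (g.c).val = c
      generalize (h.a 0).val = a'
      generalize (h.b 0).val = b'
      generalize (h.c).val = c'
      have h1 := pow_mul_pow_eq_of_mul_eq hxy hzx hzy a b'
      have h2 : Commute (z ^ c') (y ^ b * x ^ a) :=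
        ((hzy.pow_pow c' b).mul_right (hzx.pow_pow c' a))
      have h3 : Commute (z ^ (a * b')) (y ^ b) := hzy.pow_pow _ _
      calc z ^ c * z ^ c' * z ^ (a * b') * (y ^ b * y ^ b') * (x ^ a * x ^ a')
          = z ^ c * z ^ c' * (z ^ (a * b') * y ^ b) * (y ^ b' * x ^ a) * x ^ a' := by
            simp only [mul_assoc]
        _ = z ^ c * z ^ c' * y ^ b * (z ^ (a * b') * (y ^ b' * x ^ a)) * x ^ a' := by
            rw [h3.eq]; simp only [mul_assoc]
        _ = z ^ c * (z ^ c' * (y ^ b * x ^ a)) * y ^ b' * x ^ a' := by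
            rw [← h1]; simp only [mul_assoc]
        _ = _ := by rw [h2.eq]; simp only [mul_assoc])
  have hf : ∀ g, f g = z ^ (g.c).val * y ^ (g.b 0).val * x ^ (g.a 0).val := fun g => rfl
  refine ⟨(MulEquiv.ofBijective f ⟨?_, ?_⟩).symm⟩
  · rw [injective_iff_map_eq_one]
    intro g hg
    rw [hf] at hg
    -- Moving `x` past the image of `g` produces `z ^ b`, so a trivial image forces `b = 0`. Then `x
    -- ^ a` is a power of `z`, hence commutes with `y`, and this forces `a = 0`.
    have hb : g.b 0 = 0 := by
      apply hz0
      have h1 := mul_pow_eq_of_mul_eq hxy hzy (g.b 0).val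
      have e : z ^ (g.c).val * y ^ (g.b 0).val * x ^ (g.a 0).val * x
          = z ^ (g.c).val * y ^ (g.b 0).val * x * x ^ (g.a 0).val := by
        rw [mul_assoc, mul_assoc _ x, ← pow_succ, ← pow_succ']
      have e2 : x * (z ^ (g.c).val * y ^ (g.b 0).val * x ^ (g.a 0).val)
          = z ^ (g.b 0).val * (z ^ (g.c).val * y ^ (g.b 0).val * x * x ^ (g.a 0).val) := by
        calc _ = (x * z ^ (g.c).val) * y ^ (g.b 0).val * x ^ (g.a 0).val := by
              simp only [mul_assoc]
          _ = z ^ (g.c).val * (x * y ^ (g.b 0).val) * x ^ (g.a 0).val := by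
              rw [← (hzx.pow_left _).eq]; simp only [mul_assoc]
          _ = (z ^ (g.c).val * z ^ (g.b 0).val) * y ^ (g.b 0).val * x * x ^ (g.a 0).val := by
              rw [h1]; simp only [mul_assoc]
          _ = _ := by rw [((Commute.refl z).pow_pow _ _).eq]; simp only [mul_assoc]
      rw [← e, hg] at e2
      simpa using e2
    rw [hb] at hg
    simp only [ZMod.val_zero, pow_zero, mul_one] at hg
    have ha : g.a 0 = 0 := by
      apply hz0
      have h1 := pow_mul_eq_of_mul_eq hxy hzx (g.a 0).val
      have h2 : x ^ (g.a 0).val = (z ^ (g.c).val)⁻¹ := eq_inv_of_mul_eq_one_right hg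
      have h3 : Commute (x ^ (g.a 0).val) y := by
        rw [h2]; exact (hzy.pow_left _).inv_left
      rw [h3.eq] at h1
      simpa using h1
    rw [ha] at hg
    simp only [ZMod.val_zero, pow_zero, mul_one] at hg
    have hc := hz0 _ hg
    ext i
    · fin_cases i; simpa using ha
    · fin_cases i; simpa using hb
    · simpa using hc
  · intro g
    obtain ⟨a, b, c, rfl⟩ := hgen g
    refine ⟨⟨fun _ => a, fun _ => b, c⟩, ?_⟩
    rw [hf]
    simp only [pow_val_natCast hx, pow_val_natCast hy, pow_val_natCast hzN]

/-- Collection in class three: each `g` passed by `c` leaves a `w`, and the central `l` is produced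
once for each pair in which a `g` crosses a `w`, whence the triangular exponent. -/
theorem mul_pow_eq_of_mul_eq_of_mul_eq {G : Type*} [Group G] {c g w l : G}
    (h : c * g = w * (g * c)) (hw : g * w = l * (w * g)) (hl : ∀ t, Commute l t) (n : ℕ) :
    c * g ^ n = l ^ (n * (n - 1) / 2) * w ^ n * (g ^ n * c) := by
  induction n with
  | zero => simp
  | succ n ih =>
    have e : (n + 1) * (n + 1 - 1) / 2 = n * (n - 1) / 2 + n := by
      rw [← Finset.sum_range_id_mul_two, ← Finset.sum_range_id_mul_two,
        Nat.mul_div_cancel _ two_pos, Nat.mul_div_cancel _ two_pos, Finset.sum_range_succ]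
    have h1 := pow_mul_eq_of_mul_eq hw (hl g) n
    have h2 : ∀ m, ∀ t, t * l ^ m = l ^ m * t := fun m t => ((hl t).pow_left m).symm.eq
    calc c * g ^ (n + 1) = (c * g ^ n) * g := by rw [pow_succ, mul_assoc]
      _ = l ^ (n * (n - 1) / 2) * w ^ n * g ^ n * (c * g) := by rw [ih]; simp only [mul_assoc]
      _ = l ^ (n * (n - 1) / 2) * w ^ n * (g ^ n * w) * g * c := by
        rw [h]; simp only [mul_assoc]
      _ = l ^ (n * (n - 1) / 2) * (w ^ n * l ^ n) * (w * g ^ n) * g * c := by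
        rw [h1]; simp only [mul_assoc]
      _ = _ := by rw [h2 n, e, pow_add, pow_succ, pow_succ]; simp only [mul_assoc]

/-! ### Class two groups with a central extension whose centre is `ℂˣ`. -/

open scoped commutatorElement in
/-- A group `G` whose centre is cyclic of odd order `N` and contains the commutators, and which is
the central quotient of a group whose centre is `ℂˣ`, is the Heisenberg group over `ℤ/Nℤ`. -/
theorem nonempty_mulEquiv_heisenberg_of_central_extension {G Γ : Type*} [Group G] [Finite G]
    [Group Γ] (π : Γ →* G) (hπ : Function.Surjective π) (κ : ℂˣ →* Γ)
    (hκ : Function.Injective κ) (hκπ : ∀ t, π t = 1 → t ∈ κ.range)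
    (hκc : ∀ s t, Commute (κ s) t)
    (hcen : ∀ t, (∀ s, Commute t s) → π t = 1)
    (hG : commutator G ≤ Subgroup.center G) (hcyc : IsCyclic (Subgroup.center G))
    (hodd : Odd (Nat.card (Subgroup.center G))) :
    Nonempty (G ≃* Heisenberg 1 (ZMod (Nat.card (Subgroup.center G)))) := by
  obtain ⟨N, hN⟩ : ∃ N, Nat.card (Subgroup.center G) = N := ⟨_, rfl⟩
  rw [hN] at hodd ⊢
  have : NeZero N := ⟨hodd.pos.ne'⟩
  obtain ⟨ζ, hζ⟩ := hcyc.exists_generator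
  have hζN : orderOf ζ = N := by rw [orderOf_eq_card_of_forall_mem_zpowers hζ, hN]
  obtain ⟨u, hu⟩ := hπ ζ
  have huN : orderOf (π u) = N := by rw [hu, Subgroup.orderOf_coe, hζN]
  -- elements of the kernel of `π` are central
  have hker : ∀ t s, π t = 1 → Commute t s := by
    rintro t s ht
    obtain ⟨r, rfl⟩ := hκπ t ht
    exact hκc r s
  have hZcomm : ∀ w g, π w ∈ Subgroup.center G → π ⁅w, g⁆ = 1 := by
    intro w g hw
    rw [map_commutatorElement, commutatorElement_eq_one_iff_mul_comm]
    exact (Subgroup.mem_center_iff.1 hw _).symm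
  have hcomm : ∀ a b : G, ⁅a, b⁆ ∈ Subgroup.center G := fun a b =>
    hG (Subgroup.commutator_mem_commutator (Subgroup.mem_top _) (Subgroup.mem_top _))
  have huc : π u ∈ Subgroup.center G := hu ▸ ζ.2
  -- elements over the centre are powers of `u` up to the kernel
  have hpow : ∀ w, π w ∈ Subgroup.center G → ∃ n : ℕ, ∃ t, π t = 1 ∧ w = u ^ n * t := by
    intro w hw
    obtain ⟨n, hn⟩ := mem_powers_iff_mem_zpowers.2 (hζ ⟨π w, hw⟩)
    refine ⟨n, (u ^ n)⁻¹ * w, ?_, by group⟩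
    rw [map_mul, map_inv, map_pow, hu]
    have := congrArg Subtype.val hn
    simp only [SubmonoidClass.coe_pow] at this
    rw [this, inv_mul_cancel]
  -- the character `[u, ·]`
  choose φ₀ hφ₀ using fun g => hκπ ⁅u, g⁆ (hZcomm u g huc)
  let φ : Γ →* ℂˣ := MonoidHom.mk' φ₀ (fun g h => by
    apply hκ
    rw [map_mul, hφ₀, hφ₀, hφ₀]
    have h1 := (hker ⁅u, h⁆ g (hZcomm u h huc)).eq
    have h2 : ⁅u, g * h⁆ = ⁅u, g⁆ * (g * ⁅u, h⁆ * g⁻¹) := by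
      simp only [commutatorElement_def]; group
    rw [h2, ← h1, mul_inv_cancel_right])
  have hφ : ∀ g, κ (φ g) = ⁅u, g⁆ := hφ₀
  have hφrel : ∀ g, u * g = κ (φ g) * (g * u) := fun g => by
    rw [hφ, commutatorElement_def]; group
  have hφpow : ∀ n g, u ^ n * g = κ (φ g) ^ n * (g * u ^ n) := fun n g =>
    pow_mul_eq_of_mul_eq (hφrel g) (hκc _ _) n
  have hφN : ∀ g, φ g ^ N = 1 := by
    intro g
    apply hκ
    have h1 := hφpow N g
    rw [(hker (u ^ N) g (by rw [map_pow, ← huN, pow_orderOf_eq_one])).eq] at h1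
    rw [map_pow, map_one]
    simpa using h1
  obtain ⟨g, hg⟩ : ∃ g, ∀ h, ∃ n : ℕ, φ h = φ g ^ n := by
    have hle : φ.range ≤ rootsOfUnity N ℂ := by
      rintro _ ⟨h, rfl⟩
      exact (mem_rootsOfUnity _ _).2 (hφN h)
    have : Finite φ.range := Finite.of_injective _ (Subgroup.inclusion_injective hle)
    have : IsCyclic φ.range :=
      isCyclic_of_injective (Subgroup.inclusion hle) (Subgroup.inclusion_injective hle)
    obtain ⟨⟨_, g, rfl⟩, hg⟩ := IsCyclic.exists_generator (α := φ.range)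
    refine ⟨g, fun h => ?_⟩
    obtain ⟨n, hn⟩ := mem_powers_iff_mem_zpowers.2 (hg ⟨φ h, h, rfl⟩)
    exact ⟨n, (congrArg Subtype.val hn).symm⟩
  -- Every value of `φ` is a power of `φ g`, so `φ g ^ j = 1` makes `u ^ j` central in `Γ`, hence
  -- trivial in `G`.
  have hφg : ∀ j, φ g ^ j = 1 → N ∣ j := by
    intro j hj
    rw [← huN]
    apply orderOf_dvd_of_pow_eq_one
    rw [← map_pow]
    apply hcen
    intro s
    have h1 := hφpow j s
    obtain ⟨n, hn⟩ := hg s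
    rw [← map_pow, hn, pow_right_comm, hj, one_pow, map_one, one_mul] at h1
    exact h1
  have hgen : ∀ h, ∃ n : ℕ, ∃ d, φ d = 1 ∧ h = g ^ n * d := by
    intro h
    obtain ⟨n, hn⟩ := hg h
    exact ⟨n, (g ^ n)⁻¹ * h, by simp [hn], by group⟩
  have hCu : ∀ d, φ d = 1 → Commute u d := fun d hd => by
    have := hφrel d
    rwa [hd, map_one, one_mul] at this
  have hCZ : ∀ d w, φ d = 1 → π w ∈ Subgroup.center G → Commute w d := by
    intro d w hd hw
    obtain ⟨n, t, ht, rfl⟩ := hpow w hw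
    exact ((hCu d hd).pow_left n).mul_left (hker t d ht)
  have hZC : ∀ w, π w ∈ Subgroup.center G → φ w = 1 := by
    intro w hw
    obtain ⟨n, t, ht, rfl⟩ := hpow w hw
    apply hκ
    have h1 := hφrel (u ^ n * t)
    rw [(((Commute.refl u).pow_right n).mul_right (hker t u ht).symm).eq] at h1
    rw [map_one]
    simpa using h1
  have hcenter : ∀ t, Commute t g → (∀ d, φ d = 1 → Commute t d) → π t = 1 := by
    intro t h1 h2
    refine hcen t fun s => ?_
    obtain ⟨n, d, hd, rfl⟩ := hgen s
    exact (h1.pow_right n).mul_right (h2 d hd)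
  -- the kernel of `φ` is commutative modulo the kernel of `π`
  have hCC : ∀ c d, φ c = 1 → φ d = 1 → Commute (π c) (π d) := by
    intro c d hc hd
    rw [← commutatorElement_eq_one_iff_commute, ← map_commutatorElement]
    have hm : π ⁅c, d⁆ ∈ Subgroup.center G := by
      rw [map_commutatorElement]; exact hcomm _ _
    apply hcenter
    -- Conjugation by `g` multiplies `c` and `d` by elements `w` and `w'` over the centre of `G`.
    -- These commute with each other and with `c` and `d`, so `⁅c, d⁆` is unchanged.
    · have hconj : ∀ e, ∃ w, π w ∈ Subgroup.center G ∧ g * e * g⁻¹ = e * w := by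
        intro e
        refine ⟨⁅e⁻¹, g⁆, by rw [map_commutatorElement]; exact hcomm _ _, ?_⟩
        rw [commutatorElement_def]; group
      obtain ⟨w, hw, hcw⟩ := hconj c
      obtain ⟨w', hw', hdw⟩ := hconj d
      have a1 := hCZ c w hc hw
      have a2 := hCZ d w hd hw
      have a3 := hCZ c w' hc hw'
      have a4 := hCZ d w' hd hw'
      have a5 := hCZ w w' (hZC w hw) hw'
      have e1 : g * ⁅c, d⁆ * g⁻¹ = ⁅g * c * g⁻¹, g * d * g⁻¹⁆ := by
        simp only [commutatorElement_def]; group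
      have e2 : ⁅c * w, d * w'⁆ = ⁅c, d⁆ := by
        have b1 : Commute w (d * w') := a2.mul_right a5.symm
        have b2 : (c * w) * (d * w') = ⁅c, d⁆ * ((d * w') * (c * w)) := by
          calc (c * w) * (d * w') = c * (w * (d * w')) := by simp only [mul_assoc]
            _ = (c * d) * (w' * w) := by rw [b1.eq]; simp only [mul_assoc]
            _ = ⁅c, d⁆ * (d * (c * w') * w) := by
              rw [show c * d = ⁅c, d⁆ * (d * c) by rw [commutatorElement_def]; group]
              simp only [mul_assoc]
            _ = _ := by rw [← a3.eq]; simp only [mul_assoc]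
        rw [commutatorElement_def (c * w), b2]; group
      rw [hcw, hdw, e2] at e1
      exact (mul_inv_eq_iff_eq_mul.1 e1).symm
    · intro e he
      exact hCZ e _ he hm
  have hGcen : ∀ t : G, Commute t (π g) → (∀ d, φ d = 1 → Commute t (π d)) →
      t ∈ Subgroup.center G := by
    intro t h1 h2
    rw [Subgroup.mem_center_iff]
    intro s
    obtain ⟨s, rfl⟩ := hπ s
    obtain ⟨n, d, hd, rfl⟩ := hgen s
    rw [map_mul, map_pow]
    exact ((h1.pow_right n).mul_right (h2 d hd)).symm.eq
  -- an element of the kernel of `φ` whose commutator with `g` generates the centre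
  obtain ⟨c, hc, hcgen⟩ : ∃ c, φ c = 1 ∧ ∀ t ∈ Subgroup.center G, ∃ n : ℕ, t = ⁅π c, π g⁆ ^ n := by
    let ψ : φ.ker →* Subgroup.center G := MonoidHom.mk'
      (fun c => ⟨⁅π c, π g⁆, hcomm _ _⟩) (fun c d => by
        ext
        simp only [Subgroup.coe_mul, map_mul]
        have h1 := Subgroup.mem_center_iff.1 (hcomm (π d) (π g)) (π c)
        have h2 : ⁅π c * π d, π g⁆ = π c * ⁅π d, π g⁆ * (π c)⁻¹ * ⁅π c, π g⁆ := by
          simp only [commutatorElement_def]; group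
        rw [h2, h1, mul_inv_cancel_right]
        exact (Subgroup.mem_center_iff.1 (hcomm (π d) (π g)) _).symm)
    obtain ⟨⟨_, c, rfl⟩, hcg⟩ := IsCyclic.exists_generator (α := ψ.range)
    have hgc : ∀ d, ∃ n : ℕ, ψ c ^ n = ψ d := fun d => by
      obtain ⟨n, hn⟩ := mem_powers_iff_mem_zpowers.2 (hcg ⟨ψ d, d, rfl⟩)
      exact ⟨n, congrArg Subtype.val hn⟩
    -- Let `m` be the order of `ψ c`, which generates the image of `ψ`. In `G`, the image of `g ^ m`
    -- commutes with that of `ker φ`, so it is central and `φ g ^ m = 1`. Thus `N ∣ m`, and `ψ` is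
    -- onto.
    have hNd : N ∣ orderOf (ψ c) := by
      apply hφg
      rw [← map_pow]
      apply hZC
      rw [map_pow]
      apply hGcen
      · exact (Commute.refl _).pow_left _
      · intro d hd
        obtain ⟨n, hn⟩ := hgc ⟨d, hd⟩
        have h1 : π d * π g = ⁅π d, π g⁆ * (π g * π d) := by rw [commutatorElement_def]; group
        have h2 := mul_pow_eq_of_mul_eq h1
          (Subgroup.mem_center_iff.1 (hcomm (π d) (π g)) (π g)).symm (orderOf (ψ c))
        have h3 : ⁅π d, π g⁆ = ((ψ c ^ n : Subgroup.center G) : G) := by rw [hn]; rfl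
        rw [h3, ← SubmonoidClass.coe_pow, pow_right_comm, pow_orderOf_eq_one] at h2
        simp only [one_pow, Subgroup.coe_one, one_mul] at h2
        exact h2.symm
    have htop : ∀ t, t ∈ Subgroup.zpowers (ψ c) := by
      have : Subgroup.zpowers (ψ c) = ⊤ := by
        apply Subgroup.eq_top_of_le_card
        rw [hN, Nat.card_zpowers]
        exact Nat.le_of_dvd (orderOf_pos _) hNd
      simp [this]
    refine ⟨c, c.2, fun t ht => ?_⟩
    obtain ⟨n, hn⟩ := mem_powers_iff_mem_zpowers.2 (htop ⟨t, ht⟩)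
    exact ⟨n, (congrArg Subtype.val hn).symm⟩
  obtain ⟨z, hz⟩ : ∃ z, z = ⁅π c, π g⁆ := ⟨_, rfl⟩
  have hzc : z ∈ Subgroup.center G := hz ▸ hcomm _ _
  have hzcomm : ∀ t, Commute z t := fun t => (Subgroup.mem_center_iff.1 hzc t).symm
  have hzN : orderOf z = N := by
    rw [← hN, ← Subgroup.orderOf_mk z hzc]
    apply orderOf_eq_card_of_forall_mem_zpowers
    rintro ⟨t, ht⟩
    obtain ⟨n, hn⟩ := hcgen t ht
    exact ⟨n, by ext; simp [hn, hz]⟩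
  have hxy : π c * π g = z * (π g * π c) := by rw [hz, commutatorElement_def]; group
  have hzN1 : z ^ N = 1 := by rw [← hzN, pow_orderOf_eq_one]
  have hCgen : ∀ d, φ d = 1 → ∃ n m : ℕ, π d = z ^ m * π c ^ n := by
    intro d hd
    obtain ⟨n, hn⟩ := hcgen ⁅π d, π g⁆ (hcomm _ _)
    rw [← hz] at hn
    have h1 : π d * π g = z ^ n * (π g * π d) := by rw [← hn, commutatorElement_def]; group
    have h2 := pow_mul_eq_of_mul_eq hxy (hzcomm _) n
    -- `π d` and `π c ^ n` have the same commutator with `π g`, and both commute with the image of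
    -- `ker φ`; their quotient is therefore central.
    obtain ⟨m, hm⟩ := hcgen (π d * (π c ^ n)⁻¹) (by
      apply hGcen
      · rw [← mul_inv_eq_iff_eq_mul] at h1
        have h3 : (π c ^ n)⁻¹ * π g = (z ^ n)⁻¹ * (π g * (π c ^ n)⁻¹) := by
          rw [inv_mul_eq_iff_eq_mul]
          calc π g = (z ^ n)⁻¹ * (z ^ n * (π g * π c ^ n)) * (π c ^ n)⁻¹ := by group
            _ = (z ^ n)⁻¹ * π c ^ n * (π g * (π c ^ n)⁻¹) := by
              rw [← h2]; simp only [mul_assoc]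
            _ = _ := by rw [((hzcomm _).pow_pow n n).inv_left.eq]; simp only [mul_assoc]
        have h4 : π d * π g = z ^ n * (π g * π d) := by rw [← h1]; group
        calc π d * (π c ^ n)⁻¹ * π g = (π d * (z ^ n)⁻¹) * (π g * (π c ^ n)⁻¹) := by
              rw [mul_assoc, h3]; simp only [mul_assoc]
          _ = (z ^ n)⁻¹ * (π d * π g) * (π c ^ n)⁻¹ := by
              rw [← ((hzcomm _).pow_left n).inv_left.eq]; simp only [mul_assoc]
          _ = π g * (π d * (π c ^ n)⁻¹) := by rw [h4]; group
      · intro e he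
        exact (hCC d e hd he).mul_left ((hCC c e hc he).pow_left n).inv_left)
    refine ⟨n, m, ?_⟩
    rw [hz, ← hm]; group
  -- the powers of `c` and `g`
  obtain ⟨w, hw⟩ : ∃ w, w = ⁅c, g⁆ := ⟨_, rfl⟩
  have hπw : π w = z := by rw [hw, map_commutatorElement, hz]
  have hwZ : π w ∈ Subgroup.center G := hπw ▸ hzc
  have hcg : c * g = w * (g * c) := by rw [hw, commutatorElement_def]; group
  obtain ⟨l, hl⟩ : ∃ l, l = ⁅w, g⁆⁻¹ := ⟨_, rfl⟩
  have hlker : π l = 1 := by rw [hl, map_inv, hZcomm w g hwZ, inv_one]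
  have hgw : g * w = l * (w * g) := by rw [hl, commutatorElement_def]; group
  have hlc : ∀ t, Commute l t := fun t => hker l t hlker
  -- `w ^ N` lies over `z ^ N = 1`, so it is central in `Γ`, while passing `g` through it costs `l ^
  -- N`.
  have hlN : l ^ N = 1 := by
    have h1 := mul_pow_eq_of_mul_eq hgw (hlc _) N
    rw [(hker (w ^ N) g (by rw [map_pow, hπw, hzN1])).eq] at h1
    simpa using h1
  have hgN : π (g ^ N) ∈ Subgroup.center G := by
    have h1 := mul_pow_eq_of_mul_eq hxy (hzcomm _) N
    rw [hzN1, one_mul] at h1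
    rw [map_pow]
    apply hGcen
    · exact (Commute.refl _).pow_left _
    · intro d hd
      obtain ⟨n, m, hnm⟩ := hCgen d hd
      rw [hnm]
      exact ((hzcomm _).pow_left _).symm.mul_right (Commute.pow_right (Commute.symm h1) n)
  -- Since `g ^ N` lies over the centre, `c` commutes with it, and collection leaves `l ^ (N(N-1)/2)
  -- * w ^ N = 1`. Oddness enters here: the exponent of `l` is a multiple of `N`.
  have hwN : w ^ N = 1 := by
    have h1 := mul_pow_eq_of_mul_eq_of_mul_eq hcg hgw hlc N
    obtain ⟨r, hr⟩ := hodd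
    have h2 : N * (N - 1) / 2 = N * r := by
      rw [hr, Nat.add_sub_cancel, Nat.mul_left_comm, Nat.mul_div_cancel_left _ two_pos]
    rw [h2, pow_mul, hlN, one_pow, one_mul, ← (hCZ c _ hc hgN).symm.eq] at h1
    simpa using h1
  have hlift : ∀ d, φ d = 1 → ∃ n : ℕ, ∃ v, π v ∈ Subgroup.center G ∧ d = v * c ^ n := by
    intro d hd
    obtain ⟨n, m, hnm⟩ := hCgen d hd
    refine ⟨n, d * (c ^ n)⁻¹, ?_, by group⟩
    rw [map_mul, map_inv, map_pow, hnm, mul_inv_cancel_right]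
    exact Subgroup.pow_mem _ hzc m
  -- As `w ^ N = 1`, the element `c ^ N` commutes with `g`. It also commutes with `ker φ`, which
  -- consists of powers of `c` times elements over the centre. So it is central in `Γ`.
  have hcN : π c ^ N = 1 := by
    rw [← map_pow]
    apply hcenter
    · have h1 := pow_mul_eq_of_mul_eq hcg (hCZ c w hc hwZ) N
      rw [hwN, one_mul] at h1
      exact h1
    · intro d hd
      obtain ⟨n, v, hv, rfl⟩ := hlift d hd
      exact ((hCZ c v hc hv).symm.pow_left N).mul_right ((Commute.refl c).pow_pow N n)
  have hgN1 : π g ^ N = 1 := by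
    rw [← map_pow]
    apply hcenter
    · exact (Commute.refl _).pow_left _
    · intro d hd
      exact hCZ d _ hd hgN
  refine nonempty_mulEquiv_heisenberg hxy (hzcomm _) (hzcomm _) hcN hgN1 hzN fun s => ?_
  obtain ⟨s, rfl⟩ := hπ s
  obtain ⟨b, d, hd, rfl⟩ := hgen s
  obtain ⟨a, m, hm⟩ := hCgen d hd
  refine ⟨a, b, m, ?_⟩
  rw [map_mul, map_pow, hm, ← mul_assoc, ((hzcomm (π g)).pow_pow m b).eq]

/-! ### The central extension of a projective representation and Schur's lemma. -/

namespace ProjRep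

variable {G : Type*} [Group G] {V : Type*} [AddCommGroup V] [Module ℂ V]

theorem smulOfUnit_apply (c : ℂˣ) (v : V) :
    (LinearEquiv.smulOfUnit c : V ≃ₗ[ℂ] V) v = (c : ℂ) • v := rfl

/-- The central extension of `G` by the scalars defined by a projective representation. -/
def centralExtension (ρ : ProjRep G V) : Subgroup ((V ≃ₗ[ℂ] V) × G) where
  carrier := {t | ∃ c : ℂˣ, ∀ v, t.1 v = (c : ℂ) • ρ.toFun t.2 v}
  one_mem' := ⟨1, fun v => by simp [ρ.map_one]⟩
  mul_mem' := by
    rintro ⟨T, g⟩ ⟨S, h⟩ ⟨c, hc⟩ ⟨d, hd⟩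
    refine ⟨c * d * ρ.cocycle g h, fun v => ?_⟩
    simp only at hc hd
    simp [hc, hd, ρ.map_mul, smul_smul, mul_assoc]
  inv_mem' := by
    rintro ⟨T, g⟩ ⟨c, hc⟩
    refine ⟨(c * ρ.cocycle g⁻¹ g)⁻¹, fun v => ?_⟩
    simp only at hc
    obtain ⟨w, rfl⟩ := T.surjective v
    have h1 : (T, g)⁻¹.1 (T w) = w := T.symm_apply_apply w
    rw [h1, hc]
    simp only [map_smul, Prod.snd_inv, ρ.map_mul, inv_mul_cancel, ρ.map_one, smul_smul]
    rw [← Units.val_mul, ← Units.val_mul, inv_mul_cancel, Units.val_one, one_smul]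

theorem mem_centralExtension (ρ : ProjRep G V) (g : G) : (ρ.toFun g, g) ∈ ρ.centralExtension :=
  ⟨1, fun v => by simp⟩

/-- The scalars in the central extension defined by a projective representation. -/
def scalars (ρ : ProjRep G V) : ℂˣ →* ρ.centralExtension where
  toFun c := ⟨(LinearEquiv.smulOfUnit c, 1), c, fun v => by simp [ρ.map_one, smulOfUnit_apply]⟩
  map_one' := by ext <;> simp [smulOfUnit_apply]
  map_mul' c d := by
    ext
    · simp [smulOfUnit_apply, mul_smul, smul_comm (c : ℂ)]
    · simp

theorem coe_scalars (ρ : ProjRep G V) (c : ℂˣ) :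
    (ρ.scalars c : (V ≃ₗ[ℂ] V) × G) = (LinearEquiv.smulOfUnit c, 1) := rfl

/-- Schur's lemma for projective representations. -/
theorem IsIrreducible.exists_eq_smul [FiniteDimensional ℂ V] {ρ : ProjRep G V}
    (hρ : ρ.IsIrreducible) (T : V ≃ₗ[ℂ] V) (hT : ∀ g v, T (ρ.toFun g v) = ρ.toFun g (T v)) :
    ∃ c : ℂˣ, ∀ v, T v = (c : ℂ) • v := by
  obtain ⟨hV, hW⟩ := hρ
  obtain ⟨μ, hμ⟩ := Module.End.exists_eigenvalue (T : Module.End ℂ V)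
  have htop : Module.End.eigenspace (T : Module.End ℂ V) μ = ⊤ := by
    refine (hW _ fun g w hw => ?_).resolve_left hμ
    rw [Module.End.mem_eigenspace_iff] at hw ⊢
    change T w = μ • w at hw
    change T (ρ.toFun g w) = μ • ρ.toFun g w
    rw [hT, hw, map_smul]
  have h1 : ∀ v, T v = μ • v := fun v => by
    have : v ∈ Module.End.eigenspace (T : Module.End ℂ V) μ := htop ▸ Submodule.mem_top
    rw [Module.End.mem_eigenspace_iff] at this
    exact this
  have hμ0 : μ ≠ 0 := by
    rintro rfl
    obtain ⟨v, hv⟩ := exists_ne (0 : V)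
    exact hv (T.injective (by rw [h1, zero_smul, map_zero]))
  exact ⟨Units.mk0 μ hμ0, h1⟩

/-- A finite group of class at most two with cyclic centre of odd order
`N` and a faithful irreducible projective representation is a Heisenberg group over `ℤ/Nℤ`. -/
theorem nonempty_mulEquiv_heisenberg [Finite G] [FiniteDimensional ℂ V] {ρ : ProjRep G V}
    (hf : ρ.IsFaithful) (hi : ρ.IsIrreducible)
    (hG : commutator G ≤ Subgroup.center G) (hcyc : IsCyclic (Subgroup.center G))
    (hodd : Odd (Nat.card (Subgroup.center G))) :
    Nonempty (G ≃* Heisenberg 1 (ZMod (Nat.card (Subgroup.center G)))) := by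
  have := hi.1
  refine nonempty_mulEquiv_heisenberg_of_central_extension
    ((MonoidHom.snd _ _).comp ρ.centralExtension.subtype)
    (fun g => ⟨⟨_, ρ.mem_centralExtension g⟩, rfl⟩) ρ.scalars ?_ ?_ ?_ ?_ hG hcyc hodd
  · intro c d h
    have h1 := congrArg Prod.fst (congrArg Subtype.val h)
    obtain ⟨v, hv⟩ := exists_ne (0 : V)
    have h2 := LinearEquiv.congr_fun h1 v
    simp only [coe_scalars, smulOfUnit_apply] at h2
    exact Units.ext (smul_left_injective ℂ hv h2)
  · rintro ⟨⟨T, g⟩, c, hc⟩ ht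
    obtain rfl : g = 1 := ht
    refine ⟨c, ?_⟩
    ext v
    · simpa [coe_scalars, smulOfUnit_apply, ρ.map_one] using (hc v).symm
    · rfl
  · rintro s ⟨⟨T, g⟩, c, hc⟩
    ext v
    · simp [coe_scalars, smulOfUnit_apply]
    · simp [coe_scalars]
  · rintro ⟨⟨T, g⟩, c, hc⟩ ht
    change g = 1
    -- Centrality makes `T` commute with every `ρ(h)`, so `T` is a scalar; being proportional to
    -- `ρ(g)`, it puts `g` in the kernel of `ρ`.
    obtain ⟨μ, hμ⟩ := hi.exists_eq_smul T fun h v => by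
      have h1 := ht ⟨_, ρ.mem_centralExtension h⟩
      exact LinearEquiv.congr_fun (congrArg Prod.fst (congrArg Subtype.val h1.eq)) v
    have hg : g ∈ ρ.ker := ⟨c⁻¹ * μ, fun v => by
      have h1 := hc v
      simp only [hμ] at h1
      rw [Units.val_mul, mul_smul, h1, smul_smul, ← Units.val_mul, inv_mul_cancel, Units.val_one,
        one_smul]⟩
    rw [hf] at hg
    exact hg

/-! ### Constructions of projective representations. -/

/-- Pull-back of a projective representation along a homomorphism of groups. -/
def comap {H : Type*} [Group H] (ρ : ProjRep G V) (f : H →* G) : ProjRep H V where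
  toFun h := ρ.toFun (f h)
  cocycle h k := ρ.cocycle (f h) (f k)
  map_one v := by rw [_root_.map_one, ρ.map_one]
  map_mul h k v := by rw [_root_.map_mul, ρ.map_mul]

theorem IsFaithful.comap {H : Type*} [Group H] {ρ : ProjRep G V} (hρ : ρ.IsFaithful) {f : H →* G}
    (hf : Function.Injective f) : (ρ.comap f).IsFaithful := by
  ext h
  have h1 : h ∈ (ρ.comap f).ker ↔ f h ∈ ρ.ker := Iff.rfl
  rw [h1, hρ, Set.mem_singleton_iff, Set.mem_singleton_iff, map_eq_one_iff f hf]

theorem IsIrreducible.comap {H : Type*} [Group H] {ρ : ProjRep G V} (hρ : ρ.IsIrreducible)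
    {f : H →* G} (hf : Function.Surjective f) : (ρ.comap f).IsIrreducible :=
  ⟨hρ.1, fun W hW => hρ.2 W fun g w hw => by
    obtain ⟨h, rfl⟩ := hf g
    exact hW h w hw⟩

/-- Transport of a projective representation along a linear equivalence. -/
def transport {W : Type*} [AddCommGroup W] [Module ℂ W] (ρ : ProjRep G V) (e : V ≃ₗ[ℂ] W) :
    ProjRep G W where
  toFun g := e.symm.trans ((ρ.toFun g).trans e)
  cocycle := ρ.cocycle
  map_one v := by simp [ρ.map_one]
  map_mul g h v := by simp [ρ.map_mul]

theorem transport_apply {W : Type*} [AddCommGroup W] [Module ℂ W] (ρ : ProjRep G V)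
    (e : V ≃ₗ[ℂ] W) (g : G) (w : W) : (ρ.transport e).toFun g w = e (ρ.toFun g (e.symm w)) := rfl

theorem IsFaithful.transport {W : Type*} [AddCommGroup W] [Module ℂ W] {ρ : ProjRep G V}
    (hρ : ρ.IsFaithful) (e : V ≃ₗ[ℂ] W) : (ρ.transport e).IsFaithful := by
  ext g
  have h1 : g ∈ (ρ.transport e).ker ↔ g ∈ ρ.ker := by
    refine exists_congr fun c => ⟨fun h v => ?_, fun h w => ?_⟩
    · have := h (e v)
      rw [transport_apply, e.symm_apply_apply, ← map_smul] at this
      exact e.injective this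
    · rw [transport_apply, h, map_smul, e.apply_symm_apply]
  rw [h1, hρ]

theorem IsIrreducible.transport {W : Type*} [AddCommGroup W] [Module ℂ W] {ρ : ProjRep G V}
    (hρ : ρ.IsIrreducible) (e : V ≃ₗ[ℂ] W) : (ρ.transport e).IsIrreducible := by
  have := hρ.1
  refine ⟨e.symm.toEquiv.nontrivial, fun U hU => ?_⟩
  have h1 := hρ.2 (U.comap (e : V →ₗ[ℂ] W)) fun g w hw => by
    have := hU g _ hw
    rw [Submodule.mem_comap]
    simpa [transport_apply] using this
  have h2 : (U.comap (e : V →ₗ[ℂ] W)).map (e : V →ₗ[ℂ] W) = U :=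
    Submodule.map_comap_eq_of_surjective e.surjective U
  rcases h1 with h | h
  · left; rw [← h2, h, Submodule.map_bot]
  · right; rw [← h2, h, Submodule.map_top, LinearEquiv.range]

/-- A monomial projective representation, on the functions on a finite set `X`. -/
def monomial {X : Type*} (m : G → X → ℂˣ) (σ : G → Equiv.Perm X) (α : G → G → ℂˣ)
    (hm1 : ∀ x, m 1 x = 1) (hσ1 : σ 1 = 1)
    (hσ : ∀ g h x, σ h (σ g x) = σ (g * h) x)
    (hm : ∀ g h x, m g x * m h (σ g x) = α g h * m (g * h) x) : ProjRep G (X → ℂ) where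
  toFun g := LinearEquiv.trans (LinearEquiv.funCongrLeft ℂ ℂ (σ g))
    (LinearEquiv.piCongrRight fun x => LinearEquiv.smulOfUnit (m g x))
  cocycle := α
  map_one f := by
    ext x
    simp [hm1, hσ1, smulOfUnit_apply]
  map_mul g h f := by
    ext x
    have := congrArg Units.val (hm g h x)
    simp only [Units.val_mul] at this
    simp only [LinearEquiv.trans_apply, LinearEquiv.funCongrLeft_apply,
      LinearEquiv.piCongrRight_apply, LinearMap.funLeft_apply, smulOfUnit_apply, smul_eq_mul,
      Pi.smul_apply, ← hσ, ← mul_assoc, this]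

end ProjRep

/-- The standard additive character of `ℤ/Nℤ`, with values in the units of `ℂ`. -/
noncomputable def unitChar {N : ℕ} [NeZero N] (t : ZMod N) : ℂˣ :=
  Units.mk0 (ZMod.stdAddChar t) (by simp [ZMod.stdAddChar_apply])

section unitChar

variable {N : ℕ} [NeZero N]

theorem val_unitChar (t : ZMod N) : (unitChar t : ℂ) = ZMod.stdAddChar t := rfl

theorem unitChar_add (s t : ZMod N) : unitChar (s + t) = unitChar s * unitChar t :=
  Units.ext (AddChar.map_add_eq_mul _ s t)

theorem unitChar_zero : unitChar (0 : ZMod N) = 1 :=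
  Units.ext (AddChar.map_zero_eq_one _)

theorem unitChar_injective : Function.Injective (unitChar : ZMod N → ℂˣ) := fun _ _ h =>
  ZMod.injective_stdAddChar (congrArg Units.val h)

theorem unitChar_eq_one_iff {t : ZMod N} : unitChar t = 1 ↔ t = 0 := by
  rw [← unitChar_zero (N := N), unitChar_injective.eq_iff]

end unitChar

namespace ProjRep

theorem IsFaithful.finrank_mem {G V : Type*} [Group G] [AddCommGroup V] [Module ℂ V]
    [FiniteDimensional ℂ V] [Nontrivial V] {ρ : ProjRep G V} (hρ : ρ.IsFaithful) :
    Module.finrank ℂ V ∈ faithfulProjDegrees G :=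
  ⟨Module.finrank_pos, _, hρ.transport (Module.finBasis ℂ V).equivFun⟩

theorem IsIrreducible.finrank_mem {G V : Type*} [Group G] [AddCommGroup V] [Module ℂ V]
    [FiniteDimensional ℂ V] {ρ : ProjRep G V} (hf : ρ.IsFaithful) (hρ : ρ.IsIrreducible) :
    Module.finrank ℂ V ∈ faithfulIrredProjDegrees G :=
  have := hρ.1
  ⟨Module.finrank_pos, _, hf.transport (Module.finBasis ℂ V).equivFun, hρ.transport _⟩

/-! ### The irreducible representation of degree `N`. -/

section Quadratic

variable {N : ℕ} [NeZero N]

/-- The projective representation of `H₃(ℤ/Nℤ)` on the functions on `ℤ/Nℤ` in which the `x`s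
translate, `z` acts by a linear character and the `y`s by quadratic ones; `e` stands for `1/2`. -/
noncomputable def quadratic {e : ZMod N} (he : 2 * e = 1) : ProjRep (Heisenberg 1 (ZMod N)) (ZMod N → ℂ) :=
  monomial (fun g x => unitChar (g.c * x + g.b 0 * x ^ 2 * e)) (fun g => Equiv.addRight (g.a 0))
    -- Translating the phase of `h` by `a` leaves this constant. The cross term `2 e a b x = a b x`
    -- of the square is absorbed by the `a ⬝ᵥ b` in the product law.
    (fun g h => unitChar (h.c * g.a 0 + h.b 0 * (g.a 0) ^ 2 * e))
    (fun x => by simp [unitChar_zero]) (by ext; simp) (fun g h x => by simp [add_assoc])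
    (fun g h x => by
      rw [← unitChar_add, ← unitChar_add]
      congr 1
      simp only [Heisenberg.mul_b, Heisenberg.mul_c, Pi.add_apply, dotProduct,
        Finset.univ_unique, Fin.default_eq_zero, Finset.sum_singleton, Equiv.coe_addRight]
      linear_combination (x * g.a 0 * h.b 0) * he)

theorem quadratic_apply {e : ZMod N} (he : 2 * e = 1) (g : Heisenberg 1 (ZMod N)) (f : ZMod N → ℂ) (x : ZMod N) :
    (quadratic he).toFun g f x = (unitChar (g.c * x + g.b 0 * x ^ 2 * e) : ℂ) * f (x + g.a 0) := rfl

/-- A delta function excludes translation, and the constant function shows that the phase is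
constant, hence zero as at `x = 0`. Its values at `1` and `-1` separate the linear from the
quadratic coefficient, `2` being invertible. -/
theorem quadratic_isFaithful {e : ZMod N} (he : 2 * e = 1) : (quadratic he).IsFaithful := by
  ext g
  rw [Set.mem_singleton_iff]
  constructor
  · rintro ⟨c, hc⟩
    have ha : g.a 0 = 0 := by
      have h1 := congrFun (hc (Pi.single 0 1)) 0
      rw [quadratic_apply] at h1
      by_contra h
      simp [h] at h1
      exact c.ne_zero h1.symm
    have h2 : ∀ x, unitChar (g.c * x + g.b 0 * x ^ 2 * e) = c := fun x => by
      have h1 := congrFun (hc (fun _ => 1)) x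
      rw [quadratic_apply] at h1
      ext
      simpa using h1
    have h3 : ∀ x, g.c * x + g.b 0 * x ^ 2 * e = 0 := fun x => by
      rw [← unitChar_eq_one_iff, h2, ← h2 0]
      simp [unitChar_zero]
    have h4 := h3 1
    have h5 := h3 (-1)
    have hb : g.b 0 = 0 := by linear_combination h4 + h5 - g.b 0 * he
    have hcc : g.c = 0 := by linear_combination h4 - e * hb
    ext i
    · fin_cases i; simpa using ha
    · fin_cases i; simpa using hb
    · simpa using hcc
  · rintro rfl
    exact ⟨1, fun v => by simp [ProjRep.map_one]⟩

/-- A Fourier sum over the action of the centre projects a nonzero function of the subspace to a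
point of its support; translations then give every delta function. -/
theorem quadratic_isIrreducible {e : ZMod N} (he : 2 * e = 1) : (quadratic he).IsIrreducible := by
  refine ⟨inferInstance, fun W hW => ?_⟩
  by_cases hbot : W = ⊥
  · exact Or.inl hbot
  right
  obtain ⟨f, hf, hf0⟩ := W.ne_bot_iff.1 hbot
  obtain ⟨x₀, hx₀⟩ := Function.ne_iff.1 hf0
  have h1 : ∑ t : ZMod N, (unitChar (-(t * x₀)) : ℂ) • (quadratic he).toFun ⟨0, 0, t⟩ f ∈ W :=
    W.sum_mem fun t _ => W.smul_mem _ (hW _ _ hf)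
  have h2 : ∑ t : ZMod N, (unitChar (-(t * x₀)) : ℂ) • (quadratic he).toFun ⟨0, 0, t⟩ f
      = ((N : ℂ) * f x₀) • Pi.single x₀ 1 := by
    ext x
    have h3 : ∀ t : ZMod N, (unitChar (-(t * x₀)) : ℂ) * ((unitChar (t * x) : ℂ) * f x)
        = ZMod.stdAddChar (t * (x - x₀)) * f x := fun t => by
      rw [← mul_assoc, ← Units.val_mul, ← unitChar_add, val_unitChar]
      congr 3
      ring
    simp only [Finset.sum_apply, Pi.smul_apply, quadratic_apply, smul_eq_mul, Pi.zero_apply,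
      zero_mul, add_zero, h3, ← Finset.sum_mul]
    rw [AddChar.sum_mulShift _ (ZMod.isPrimitive_stdAddChar N), ZMod.card]
    by_cases hx : x = x₀
    · subst hx; simp
    · simp [hx, sub_eq_zero]
  rw [h2, W.smul_mem_iff (mul_ne_zero (Nat.cast_ne_zero.2 (NeZero.ne N)) hx₀)] at h1
  have h4 : ∀ x, Pi.single x (1 : ℂ) ∈ W := by
    intro x
    have h5 := hW ⟨fun _ => x₀ - x, 0, 0⟩ _ h1
    convert h5 using 1
    ext y
    rw [quadratic_apply]
    have h6 : y + (x₀ - x) = x₀ ↔ y = x := by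
      rw [← sub_eq_zero, ← sub_eq_zero (a := y)]
      ring_nf
    simp [unitChar_zero, Pi.single_apply, h6]
  rw [eq_top_iff]
  rintro f -
  rw [← Finset.univ_sum_single f]
  refine W.sum_mem fun x _ => ?_
  have := W.smul_mem (f x) (h4 x)
  rwa [← Pi.single_smul, smul_eq_mul, mul_one] at this

end Quadratic

/-! ### The reducible faithful representation for general `n`. -/

section Split

variable {N : ℕ} [NeZero N] {n₁ n₂ : ℕ}

/-- A projective representation of `H_{2(n₁+n₂)+1}(ℤ/Nℤ)` on the functions on the disjoint union of
`(ℤ/Nℤ)^n₁` and `(ℤ/Nℤ)^n₂`; the centre acts trivially on the first summand and by a faithful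
character on the second. -/
noncomputable def split (n₁ n₂ : ℕ) (N : ℕ) [NeZero N] :
    ProjRep (Heisenberg (n₁ + n₂) (ZMod N)) ((Fin n₁ → ZMod N) ⊕ (Fin n₂ → ZMod N) → ℂ) :=
  monomial
    (fun g => Sum.elim (fun x => unitChar (-(x ⬝ᵥ (g.b ∘ Fin.castAdd n₂))))
      (fun x => unitChar (g.c + x ⬝ᵥ (g.b ∘ Fin.natAdd n₁))))
    (fun g => Equiv.sumCongr (Equiv.addRight (g.a ∘ Fin.castAdd n₂))
      (Equiv.addRight (g.a ∘ Fin.natAdd n₁)))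
    -- Both summands must share one cocycle. On the second, the central character absorbs all of `a
    -- ⬝ᵥ b` and leaves minus the first block; the sign of the phase on the first summand is chosen
    -- to match.
    (fun g h => unitChar (-((g.a ∘ Fin.castAdd n₂) ⬝ᵥ (h.b ∘ Fin.castAdd n₂))))
    (by rintro (x | x) <;> simp [unitChar_zero, Pi.zero_comp])
    (by ext (x | x) <;> simp [Pi.zero_comp])
    (by rintro g h (x | x) <;> simp [add_assoc, Pi.add_comp])
    (by
      rintro g h (x | x)
      · simp only [Sum.elim_inl, Equiv.sumCongr_apply, Sum.map_inl, Equiv.coe_addRight,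
          ← unitChar_add, Heisenberg.mul_b, Pi.add_comp, dotProduct_add, add_dotProduct]
        congr 1
        ring
      · have h1 : g.a ⬝ᵥ h.b = (g.a ∘ Fin.castAdd n₂) ⬝ᵥ (h.b ∘ Fin.castAdd n₂)
            + (g.a ∘ Fin.natAdd n₁) ⬝ᵥ (h.b ∘ Fin.natAdd n₁) := Fin.sum_univ_add _
        simp only [Sum.elim_inr, Equiv.sumCongr_apply, Sum.map_inr, Equiv.coe_addRight,
          ← unitChar_add, Heisenberg.mul_b, Heisenberg.mul_c, Pi.add_comp, dotProduct_add,
          add_dotProduct, h1]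
        congr 1
        ring)

theorem split_apply_inl (g : Heisenberg (n₁ + n₂) (ZMod N))
    (f : (Fin n₁ → ZMod N) ⊕ (Fin n₂ → ZMod N) → ℂ) (x : Fin n₁ → ZMod N) :
    (split n₁ n₂ N).toFun g f (Sum.inl x) = (unitChar (-(x ⬝ᵥ (g.b ∘ Fin.castAdd n₂))) : ℂ)
      * f (Sum.inl (x + g.a ∘ Fin.castAdd n₂)) := rfl

theorem split_apply_inr (g : Heisenberg (n₁ + n₂) (ZMod N))
    (f : (Fin n₁ → ZMod N) ⊕ (Fin n₂ → ZMod N) → ℂ) (x : Fin n₂ → ZMod N) :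
    (split n₁ n₂ N).toFun g f (Sum.inr x) = (unitChar (g.c + x ⬝ᵥ (g.b ∘ Fin.natAdd n₁)) : ℂ)
      * f (Sum.inr (x + g.a ∘ Fin.natAdd n₁)) := rfl

/-- Delta functions exclude translations. The phase is trivial at the origin of the first summand,
so the scalar is `1`; the origin of the second then gives `c = 0`, and the unit vectors give `b =
0`. -/
theorem split_isFaithful : (split n₁ n₂ N).IsFaithful := by
  ext g
  rw [Set.mem_singleton_iff]
  constructor
  · rintro ⟨c, hc⟩
    have ha1 : g.a ∘ Fin.castAdd n₂ = 0 := by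
      have h1 := congrFun (hc (Pi.single (Sum.inl 0) 1)) (Sum.inl 0)
      rw [split_apply_inl] at h1
      by_contra h
      simp [h] at h1
      exact c.ne_zero h1.symm
    have ha2 : g.a ∘ Fin.natAdd n₁ = 0 := by
      have h1 := congrFun (hc (Pi.single (Sum.inr 0) 1)) (Sum.inr 0)
      rw [split_apply_inr] at h1
      by_contra h
      simp [h] at h1
      exact c.ne_zero h1.symm
    have h1 : ∀ x, unitChar (-(x ⬝ᵥ (g.b ∘ Fin.castAdd n₂))) = c := fun x => by
      have h1 := congrFun (hc (fun _ => 1)) (Sum.inl x)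
      rw [split_apply_inl] at h1
      ext
      simpa using h1
    have h2 : ∀ x, unitChar (g.c + x ⬝ᵥ (g.b ∘ Fin.natAdd n₁)) = c := fun x => by
      have h1 := congrFun (hc (fun _ => 1)) (Sum.inr x)
      rw [split_apply_inr] at h1
      ext
      simpa using h1
    have hc1 : c = 1 := by
      rw [← h1 0]
      simp [unitChar_zero]
    simp only [hc1, unitChar_eq_one_iff] at h1 h2
    have hgc : g.c = 0 := by simpa using h2 0
    have hb1 : g.b ∘ Fin.castAdd n₂ = 0 := by
      ext i
      simpa using h1 (Pi.single i 1)
    have hb2 : g.b ∘ Fin.natAdd n₁ = 0 := by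
      ext i
      simpa [hgc] using h2 (Pi.single i 1)
    ext i
    · refine Fin.addCases (fun i => ?_) (fun i => ?_) i
      · simpa using congrFun ha1 i
      · simpa using congrFun ha2 i
    · refine Fin.addCases (fun i => ?_) (fun i => ?_) i
      · simpa using congrFun hb1 i
      · simpa using congrFun hb2 i
    · simpa using hgc
  · rintro rfl
    exact ⟨1, fun v => by simp [ProjRep.map_one]⟩

end Split

end ProjRep

theorem pow_add_pow_mem_faithfulProjDegrees (n₁ n₂ N : ℕ) [NeZero N] :
    N ^ n₁ + N ^ n₂ ∈ faithfulProjDegrees (Heisenberg (n₁ + n₂) (ZMod N)) := by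
  have h := (ProjRep.split_isFaithful (n₁ := n₁) (n₂ := n₂) (N := N)).finrank_mem
  simpa [ZMod.card] using h

theorem mem_faithfulIrredProjDegrees_heisenberg {N : ℕ} [NeZero N] (hN : Odd N) :
    N ∈ faithfulIrredProjDegrees (Heisenberg 1 (ZMod N)) := by
  obtain ⟨e, he⟩ : ∃ e : ZMod N, 2 * e = 1 := by
    obtain ⟨r, hr⟩ := hN
    -- With `N = 2r + 1`, the class of `-r` is the inverse of `2` modulo `N`.
    refine ⟨-r, ?_⟩
    have h1 : (N : ZMod N) = 2 * r + 1 := by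
      exact_mod_cast congrArg (Nat.cast : ℕ → ZMod N) hr
    rw [ZMod.natCast_self] at h1
    linear_combination h1
  have h := (ProjRep.quadratic_isIrreducible he).finrank_mem (ProjRep.quadratic_isFaithful he)
  simpa [ZMod.card] using h

/-! ### The lower bound by joint eigenvectors. -/

open Module (finrank)

section JointEigenvectors

variable {V : Type*} [AddCommGroup V] [Module ℂ V]

theorem pow_apply_eq_of_eigenvector (T : V ≃ₗ[ℂ] V) {c : ℂˣ} {v : V} (h : T v = (c : ℂ) • v)
    (n : ℕ) : (T ^ n) v = ((c ^ n : ℂˣ) : ℂ) • v := by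
  induction n with
  | zero => simp
  | succ n ih =>
    rw [pow_succ', LinearEquiv.mul_apply, ih, map_smul, h, smul_smul, ← Units.val_mul, pow_succ]

theorem units_eq_of_smul_eq {c d : ℂˣ} {v : V} (hv : v ≠ 0) (h : (c : ℂ) • v = (d : ℂ) • v) :
    c = d :=
  Units.ext (smul_left_injective ℂ hv h)

variable [FiniteDimensional ℂ V]

/-- Joint generalized eigenspaces of commuting operators are independent, so eigenvectors with
distinct pairs of eigenvalues are too. -/
theorem card_le_finrank_of_joint_eigenvectors {ι : Type*} [Fintype ι] {P Q : Module.End ℂ V}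
    (hPQ : Commute P Q) (v : ι → V) (a b : ι → ℂ) (hv : ∀ i, v i ≠ 0)
    (hP : ∀ i, P (v i) = a i • v i) (hQ : ∀ i, Q (v i) = b i • v i)
    (hab : ∀ i j, a i = a j → b i = b j → i = j) : Fintype.card ι ≤ finrank ℂ V := by
  let f : Bool → Module.End ℂ V := fun t => if t then P else Q
  have hf : ∀ s t, Commute (f s) (f t) := by
    rintro (_ | _) (_ | _)
    · exact Commute.refl _
    · exact hPQ.symm
    · exact hPQ
    · exact Commute.refl _
  have h1 := Module.End.independent_iInf_maxGenEigenspace_of_forall_mapsTo f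
    (fun s t φ => Module.End.mapsTo_maxGenEigenspace_of_comm (hf t s) φ)
  let χ : ι → Bool → ℂ := fun i t => if t then a i else b i
  have hχ : Function.Injective χ := fun i j h =>
    hab i j (by simpa [χ] using congrFun h true) (by simpa [χ] using congrFun h false)
  have h2 := h1.comp hχ
  have h3 := h2.linearIndependent (v := v) _ (fun i => by
    simp only [Function.comp, Submodule.mem_iInf]
    rintro (_ | _)
    · exact Module.End.eigenspace_le_maxGenEigenspace
        (Module.End.mem_eigenspace_iff.2 (hQ i))
    · exact Module.End.eigenspace_le_maxGenEigenspace
        (Module.End.mem_eigenspace_iff.2 (hP i))) hv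
  exact h3.fintype_card_le_finrank

theorem exists_eigenvector_mem [Nontrivial V] (T : V ≃ₗ[ℂ] V) {W : Submodule ℂ V} (hW : W ≠ ⊥)
    (hT : ∀ w ∈ W, T w ∈ W) : ∃ c : ℂˣ, ∃ w ∈ W, w ≠ 0 ∧ T w = (c : ℂ) • w := by
  have : Nontrivial W := Submodule.nontrivial_iff_ne_bot.2 hW
  obtain ⟨μ, hμ⟩ := Module.End.exists_eigenvalue ((T : V →ₗ[ℂ] V).restrict hT)
  obtain ⟨w, hw⟩ := hμ.exists_hasEigenvector
  have h1 : T w = μ • (w : V) := congrArg Subtype.val hw.apply_eq_smul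
  have h2 : (w : V) ≠ 0 := fun h => hw.2 (Subtype.ext h)
  have h3 : μ ≠ 0 := by
    rintro rfl
    exact h2 (T.injective (by rw [h1, zero_smul, map_zero]))
  exact ⟨Units.mk0 μ h3, w, w.2, h2, h1⟩

/-- An operator of finite order modulo scalars is determined by its eigenvalues. -/
theorem pow_eq_smul_of_forall_eigenvalue (Z : V ≃ₗ[ℂ] V) {N : ℕ} (hN : N ≠ 0) {e : ℂˣ}
    (hZ : ∀ v, (Z ^ N) v = (e : ℂ) • v) {M : ℕ} {c : ℂˣ}
    (h : ∀ ζ : ℂˣ, ∀ v, v ≠ 0 → Z v = (ζ : ℂ) • v → ζ ^ M = c) :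
    ∀ v, (Z ^ M) v = (c : ℂ) • v := by
  have hcoe : ∀ n v, ((Z : Module.End ℂ V) ^ n) v = (Z ^ n) v := by
    intro n v
    induction n generalizing v with
    | zero => rfl
    | succ n ih => rw [pow_succ, pow_succ, Module.End.mul_apply, ih]; rfl
  -- `Z` is a root of the separable polynomial `X ^ N - e`, so it is diagonalizable and its
  -- eigenvectors span.
  have hss : Module.End.IsSemisimple (Z : Module.End ℂ V) := by
    refine Module.End.isSemisimple_of_squarefree_aeval_eq_zero
      (p := Polynomial.X ^ N - Polynomial.C (e : ℂ)) ?_ ?_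
    · exact ((Polynomial.separable_X_pow_sub_C (e : ℂ) (by exact_mod_cast hN)
        e.ne_zero)).squarefree
    · ext v
      simp [hcoe, hZ, Module.algebraMap_end_apply]
  have htop : (⨆ μ, Module.End.eigenspace (Z : Module.End ℂ V) μ) = ⊤ := by
    rw [← Module.End.iSup_maxGenEigenspace_eq_top (Z : Module.End ℂ V)]
    exact iSup_congr fun μ =>
      (hss.isFinitelySemisimple.maxGenEigenspace_eq_eigenspace μ).symm
  have hle : (⨆ μ, Module.End.eigenspace (Z : Module.End ℂ V) μ)
      ≤ LinearMap.eqLocus ((Z ^ M : V ≃ₗ[ℂ] V) : V →ₗ[ℂ] V) ((c : ℂ) • LinearMap.id) := by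
    refine iSup_le fun μ v hv => ?_
    rw [Module.End.mem_eigenspace_iff] at hv
    change Z v = μ • v at hv
    change (Z ^ M) v = (c : ℂ) • v
    by_cases hv0 : v = 0
    · simp [hv0]
    have hμ : μ ≠ 0 := by
      rintro rfl
      exact hv0 (Z.injective (by rw [hv, zero_smul, map_zero]))
    have h1 : Z v = (Units.mk0 μ hμ : ℂ) • v := hv
    rw [pow_apply_eq_of_eigenvector Z h1, h _ v hv0 h1]
  intro v
  have : v ∈ LinearMap.eqLocus ((Z ^ M : V ≃ₗ[ℂ] V) : V →ₗ[ℂ] V) ((c : ℂ) • LinearMap.id) :=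
    hle (htop ▸ Submodule.mem_top)
  exact this

/-- Operators satisfying the Heisenberg relations up to scalars, the commutator being of order
exactly `p ^ k` modulo scalars, live in dimension at least `p ^ k`. -/
theorem pow_le_finrank_of_orderOf_dvd [Nontrivial V] {p k : ℕ} (hp : p.Prime) (hodd : Odd p)
    (A B Z : V ≃ₗ[ℂ] V) (s l₁ l₂ a e : ℂˣ)
    (hAB : ∀ v, A (B v) = (s : ℂ) • Z (B (A v))) (hA : ∀ v, Z (A v) = (l₁ : ℂ) • A (Z v))
    (hB : ∀ v, Z (B v) = (l₂ : ℂ) • B (Z v))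
    (hAN : ∀ v, (A ^ p ^ (k + 1)) v = (a : ℂ) • v) (hZN : ∀ v, (Z ^ p ^ (k + 1)) v = (e : ℂ) • v)
    (hZ : ¬ ∃ c : ℂˣ, ∀ v, (Z ^ p ^ k) v = (c : ℂ) • v)
    (hl₁ : l₁ ^ p ^ (k + 1) = 1) (hl : orderOf l₂ ∣ orderOf l₁) :
    p ^ (k + 1) ≤ finrank ℂ V := by
  obtain ⟨j, hj, hr⟩ := (Nat.dvd_prime_pow hp).1 (orderOf_dvd_of_pow_eq_one hl₁)
  obtain ⟨r, hr'⟩ : ∃ r, r = p ^ j := ⟨_, rfl⟩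
  have hr1 : l₁ ^ r = 1 := by rw [hr', ← hr, pow_orderOf_eq_one]
  have hr2 : l₂ ^ r = 1 := by rw [hr', ← hr]; exact orderOf_dvd_iff_pow_eq_one.1 hl
  have hrq : r * p ^ (k + 1 - j) = p ^ (k + 1) := by
    rw [hr', ← pow_add, Nat.add_sub_cancel' hj]
  have hAe : ∀ {ζ : ℂˣ} {v : V}, Z v = (ζ : ℂ) • v → ∀ n : ℕ,
      Z ((A ^ n) v) = ((l₁ ^ n * ζ : ℂˣ) : ℂ) • (A ^ n) v := by
    intro ζ v h n
    induction n with
    | zero => simpa using h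
    | succ n ih =>
      rw [pow_succ', LinearEquiv.mul_apply, hA, ih, map_smul, smul_smul, ← Units.val_mul,
        pow_succ', mul_assoc]
  have hBe : ∀ {ζ : ℂˣ} {v : V}, Z v = (ζ : ℂ) • v → ∀ n : ℕ,
      Z ((B ^ n) v) = ((l₂ ^ n * ζ : ℂˣ) : ℂ) • (B ^ n) v := by
    intro ζ v h n
    induction n with
    | zero => simpa using h
    | succ n ih =>
      rw [pow_succ', LinearEquiv.mul_apply, hB, ih, map_smul, smul_smul, ← Units.val_mul,
        pow_succ', mul_assoc]
  have hABn : ∀ {ζ : ℂˣ} {v : V}, Z v = (ζ : ℂ) • v → ∀ n : ℕ, (A ^ n) (B v) =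
      (((s * l₂ * ζ) ^ n * l₁ ^ (∑ i ∈ Finset.range (n + 1), i) : ℂˣ) : ℂ) • B ((A ^ n) v) := by
    intro ζ v h n
    induction n with
    | zero => simp
    | succ n ih =>
      have h1 := hAe h (n + 1)
      have h2 := hBe h1 1
      rw [pow_one, pow_succ' A, LinearEquiv.mul_apply] at h2
      rw [pow_succ' A, LinearEquiv.mul_apply, ih, map_smul, hAB, h2, smul_smul, smul_smul,
        ← Units.val_mul, ← Units.val_mul, Finset.sum_range_succ _ (n + 1), LinearEquiv.mul_apply]
      congr 2
      generalize ∑ i ∈ Finset.range (n + 1), i = S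
      simp only [pow_add, pow_one]
      ac_rfl
  -- The power of `l₁` disappears because `r` is odd, so `r(r+1)/2` is a multiple of `r`; that of
  -- `l₂` because its order divides `r`.
  have hABr : ∀ {ζ : ℂˣ} {v : V}, Z v = (ζ : ℂ) • v →
      (A ^ r) (B v) = (((s * ζ) ^ r : ℂˣ) : ℂ) • B ((A ^ r) v) := by
    intro ζ v h
    rw [hABn h r]
    congr 2
    obtain ⟨m, hm⟩ : Odd r := hr' ▸ hodd.pow
    have h1 : ∑ i ∈ Finset.range (r + 1), i = r * (m + 1) := by
      rw [Finset.sum_range_id, Nat.add_sub_cancel]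
      conv_lhs => rw [hm]
      rw [show (2 * m + 1 + 1) * (2 * m + 1) = 2 * ((2 * m + 1) * (m + 1)) by ring,
        Nat.mul_div_cancel_left _ two_pos, ← hm]
    rw [h1, pow_mul l₁, hr1, one_pow, mul_one, mul_right_comm, mul_pow _ l₂, hr2, mul_one]
  have hjoint : ∀ {ζ : ℂˣ} {v : V}, v ≠ 0 → Z v = (ζ : ℂ) • v →
      ∃ α : ℂˣ, ∃ w, w ≠ 0 ∧ Z w = (ζ : ℂ) • w ∧ (A ^ r) w = (α : ℂ) • w := by
    intro ζ v hv h
    obtain ⟨α, w, hw, hw0, hw1⟩ := exists_eigenvector_mem (A ^ r)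
      (W := Module.End.eigenspace (Z : Module.End ℂ V) ζ)
      ((Submodule.ne_bot_iff _).2 ⟨v, Module.End.mem_eigenspace_iff.2 h, hv⟩) (fun w hw => by
        rw [Module.End.mem_eigenspace_iff] at hw ⊢
        have := hAe (v := w) hw r
        rwa [hr1, one_mul] at this)
    exact ⟨α, w, hw0, Module.End.mem_eigenspace_iff.1 hw, hw1⟩
  -- `A ^ p ^ (k + 1)` is a scalar, so it has the same eigenvalue on `w` and on `B w`.
  have hν : ∀ {ζ : ℂˣ} {v : V}, v ≠ 0 → Z v = (ζ : ℂ) • v →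
      ((s * ζ) ^ r) ^ p ^ (k + 1 - j) = 1 := by
    intro ζ v hv h
    obtain ⟨α, w, hw0, hw1, hw2⟩ := hjoint hv h
    have h1 := pow_apply_eq_of_eigenvector (A ^ r) hw2 (p ^ (k + 1 - j))
    have h2 := hABr hw1
    rw [hw2, map_smul, smul_smul, ← Units.val_mul] at h2
    have h3 := pow_apply_eq_of_eigenvector (A ^ r) h2 (p ^ (k + 1 - j))
    rw [← pow_mul, hrq, hAN] at h1 h3
    have h4 := units_eq_of_smul_eq hw0 h1
    have h5 := units_eq_of_smul_eq (B.map_ne_zero_iff.2 hw0) h3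
    rw [h4, mul_pow] at h5
    exact mul_eq_right.1 h5.symm
  -- For `j ≤ k`, if no eigenvalue reached the full order, all would satisfy `(s ζ) ^ p ^ k = 1`,
  -- and `Z ^ p ^ k` would be a scalar. For `j = k + 1` the required order is `1` and any eigenvalue
  -- serves.
  obtain ⟨ζ, v, hv, hζ, hord⟩ : ∃ ζ : ℂˣ, ∃ v, v ≠ 0 ∧ Z v = (ζ : ℂ) • v ∧
      orderOf ((s * ζ) ^ r) = p ^ (k + 1 - j) := by
    by_contra! hcon
    rcases hj.lt_or_eq with hlt | rfl
    · refine hZ ⟨(s ^ p ^ k)⁻¹, pow_eq_smul_of_forall_eigenvalue Z (pow_pos hp.pos _).ne' hZN ?_⟩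
      intro ζ v hv h
      have h1 := hcon ζ v hv h
      have h2 := hν hv h
      obtain ⟨i, hi⟩ : ∃ i, k + 1 - j = i + 1 := ⟨k - j, by omega⟩
      rw [hi] at h1 h2
      have := Fact.mk hp
      have h3 : ((s * ζ) ^ r) ^ p ^ i = 1 := by
        by_contra h3
        exact h1 (orderOf_eq_prime_pow h3 h2)
      rw [← pow_mul, hr', ← pow_add, show j + i = k by omega, mul_pow] at h3
      exact eq_inv_of_mul_eq_one_right h3
    · obtain ⟨ζ, v, -, hv, h⟩ := exists_eigenvector_mem Z (W := ⊤) top_ne_bot (by simp)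
      refine hcon ζ v hv h ?_
      have := hν hv h
      rw [Nat.sub_self, pow_zero, pow_one] at this
      rw [this, orderOf_one, Nat.sub_self, pow_zero]
  obtain ⟨α, w, hw0, hw1, hw2⟩ := hjoint hv hζ
  have hBr : ∀ n : ℕ, (A ^ r) ((B ^ n) w) =
      (((((s * ζ) ^ r) ^ n * α : ℂˣ)) : ℂ) • (B ^ n) w := by
    intro n
    induction n with
    | zero => simpa using hw2
    | succ n ih =>
      have h1 : (s * (l₂ ^ n * ζ)) ^ r = (s * ζ) ^ r := by
        rw [mul_left_comm, mul_pow (l₂ ^ n), pow_right_comm, hr2, one_pow, one_mul]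
      rw [pow_succ' B, LinearEquiv.mul_apply, hABr (hBe hw1 n), ih, map_smul, smul_smul,
        ← Units.val_mul, h1, pow_succ', mul_assoc]
  have hcomm : Commute (Z : Module.End ℂ V) ((A ^ r : V ≃ₗ[ℂ] V) : Module.End ℂ V) := by
    have h1 : ∀ n v, Z ((A ^ n) v) = ((l₁ ^ n : ℂˣ) : ℂ) • (A ^ n) (Z v) := by
      intro n v
      induction n with
      | zero => simp
      | succ n ih =>
        rw [pow_succ' A, LinearEquiv.mul_apply, hA, ih, map_smul, smul_smul, ← Units.val_mul,
          pow_succ', LinearEquiv.mul_apply]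
    ext v
    have h2 := h1 r v
    rw [hr1, Units.val_one, one_smul] at h2
    exact h2
  -- For the vectors `A ^ i B ^ i' w`, the eigenvalue of `A ^ r` determines `i'`, and then that of
  -- `Z` determines `i`.
  have h := card_le_finrank_of_joint_eigenvectors (ι := Fin r × Fin (p ^ (k + 1 - j))) hcomm
    (fun i => (A ^ (i.1 : ℕ)) ((B ^ (i.2 : ℕ)) w))
    (fun i => ((l₁ ^ (i.1 : ℕ) * (l₂ ^ (i.2 : ℕ) * ζ) : ℂˣ) : ℂ))
    (fun i => ((((s * ζ) ^ r) ^ (i.2 : ℕ) * α : ℂˣ) : ℂ))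
    (fun i => (LinearEquiv.map_ne_zero_iff _).2 ((LinearEquiv.map_ne_zero_iff _).2 hw0))
    (fun i => hAe (hBe hw1 _) _)
    (fun i => by
      change (A ^ r) ((A ^ (i.1 : ℕ)) ((B ^ (i.2 : ℕ)) w)) = _
      rw [← LinearEquiv.mul_apply, ← pow_add, add_comm, pow_add, LinearEquiv.mul_apply, hBr,
        map_smul])
    (by
      rintro ⟨i, i'⟩ ⟨m, m'⟩ h1 h2
      simp only [Units.val_inj] at h1 h2
      have h3 : i' = m' := Fin.ext (pow_injOn_Iio_orderOf (by simp [hord])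
        (by simp [hord]) (mul_right_cancel h2))
      subst h3
      have h4 : i = m := Fin.ext (pow_injOn_Iio_orderOf (by simp [hr, ← hr'])
        (by simp [hr, ← hr']) (mul_right_cancel h1))
      rw [h4])
  simpa [hrq] using h

end JointEigenvectors

/-! ### The lower bound for faithful projective representations. -/

namespace ProjRep

variable {G : Type*} [Group G] {V : Type*} [AddCommGroup V] [Module ℂ V]

theorem exists_pow_apply (ρ : ProjRep G V) (g : G) (n : ℕ) :
    ∃ c : ℂˣ, ∀ v, (ρ.toFun g ^ n) v = (c : ℂ) • ρ.toFun (g ^ n) v := by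
  induction n with
  | zero => exact ⟨1, fun v => by simp [ρ.map_one]⟩
  | succ n ih =>
    obtain ⟨c, hc⟩ := ih
    refine ⟨c * ρ.cocycle g (g ^ n), fun v => ?_⟩
    rw [pow_succ', LinearEquiv.mul_apply, hc, map_smul, ρ.map_mul, smul_smul, Units.val_mul,
      pow_succ']

theorem exists_smul_of_mul_eq (ρ : ProjRep G V) {g h g' h' : G} (e : g * h = g' * h') :
    ∃ c : ℂˣ, ∀ v, ρ.toFun g (ρ.toFun h v) = (c : ℂ) • ρ.toFun g' (ρ.toFun h' v) :=
  ⟨ρ.cocycle g h * (ρ.cocycle g' h')⁻¹, fun v => by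
    rw [ρ.map_mul, ρ.map_mul, e, smul_smul, ← Units.val_mul, inv_mul_cancel_right]⟩

theorem exists_pow_apply_eq_smul (ρ : ProjRep G V) {g : G} {n : ℕ} (hg : g ^ n = 1) :
    ∃ c : ℂˣ, ∀ v, (ρ.toFun g ^ n) v = (c : ℂ) • v := by
  obtain ⟨c, hc⟩ := ρ.exists_pow_apply g n
  exact ⟨c, fun v => by rw [hc, hg, ρ.map_one]⟩

/-- A faithful projective representation of a group containing Heisenberg generators of order
`p ^ (k + 1)` has degree at least `p ^ (k + 1)`. -/
theorem IsFaithful.pow_le_finrank [FiniteDimensional ℂ V] [Nontrivial V] {ρ : ProjRep G V}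
    (hρ : ρ.IsFaithful) {p k : ℕ} (hp : p.Prime) (hodd : Odd p) {x y z : G}
    (hxy : x * y = z * (y * x)) (hzx : Commute z x) (hzy : Commute z y)
    (hx : x ^ p ^ (k + 1) = 1) (hy : y ^ p ^ (k + 1) = 1) (hz : z ^ p ^ (k + 1) = 1)
    (hz1 : z ^ p ^ k ≠ 1) : p ^ (k + 1) ≤ Module.finrank ℂ V := by
  obtain ⟨s₁, hs₁⟩ := ρ.exists_smul_of_mul_eq hxy
  obtain ⟨s, hs⟩ : ∃ s : ℂˣ, ∀ v, ρ.toFun x (ρ.toFun y v)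
      = (s : ℂ) • ρ.toFun z (ρ.toFun y (ρ.toFun x v)) :=
    ⟨s₁ * (ρ.cocycle y x)⁻¹, fun v => by
      rw [hs₁, ρ.map_mul y x, map_smul, smul_smul, ← Units.val_mul, inv_mul_cancel_right]⟩
  obtain ⟨l₁, hl₁⟩ := ρ.exists_smul_of_mul_eq hzx.eq
  obtain ⟨l₂, hl₂⟩ := ρ.exists_smul_of_mul_eq hzy.eq
  obtain ⟨a, ha⟩ := ρ.exists_pow_apply_eq_smul hx
  obtain ⟨b, hb⟩ := ρ.exists_pow_apply_eq_smul hy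
  obtain ⟨e, he⟩ := ρ.exists_pow_apply_eq_smul hz
  have hord : ∀ (A : V ≃ₗ[ℂ] V) (l : ℂˣ),
      (∀ v, ρ.toFun z (A v) = (l : ℂ) • A (ρ.toFun z v)) → l ^ p ^ (k + 1) = 1 := by
    intro A l h
    have h1 : ∀ n v, (ρ.toFun z ^ n) (A v) = ((l ^ n : ℂˣ) : ℂ) • A ((ρ.toFun z ^ n) v) := by
      intro n v
      induction n with
      | zero => simp
      | succ n ih =>
        rw [pow_succ', LinearEquiv.mul_apply, ih, map_smul, h, smul_smul, ← Units.val_mul,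
          pow_succ, LinearEquiv.mul_apply]
    obtain ⟨v, hv⟩ := exists_ne (0 : V)
    have h2 := h1 (p ^ (k + 1)) v
    rw [he, he, map_smul, smul_smul, ← Units.val_mul] at h2
    exact (mul_eq_right.1 (units_eq_of_smul_eq (A.map_ne_zero_iff.2 hv) h2).symm)
  have hZ : ¬ ∃ c : ℂˣ, ∀ v, (ρ.toFun z ^ p ^ k) v = (c : ℂ) • v := by
    rintro ⟨c, hc⟩
    obtain ⟨d, hd⟩ := ρ.exists_pow_apply z (p ^ k)
    have h1 : z ^ p ^ k ∈ ρ.ker := ⟨d⁻¹ * c, fun v => by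
      rw [Units.val_mul, mul_smul, ← hc, hd, smul_smul, ← Units.val_mul, inv_mul_cancel,
        Units.val_one, one_smul]⟩
    rw [hρ] at h1
    exact hz1 h1
  have hcomp : orderOf l₂ ∣ orderOf l₁ ∨ orderOf l₁ ∣ orderOf l₂ := by
    obtain ⟨i, -, hi⟩ := (Nat.dvd_prime_pow hp).1 (orderOf_dvd_of_pow_eq_one (hord _ _ hl₁))
    obtain ⟨j, -, hj⟩ := (Nat.dvd_prime_pow hp).1 (orderOf_dvd_of_pow_eq_one (hord _ _ hl₂))
    rw [hi, hj]
    exact (le_total j i).imp (pow_dvd_pow p) (pow_dvd_pow p)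
  rcases hcomp with h | h
  · exact pow_le_finrank_of_orderOf_dvd hp hodd _ _ _ s l₁ l₂ a e hs hl₁ hl₂ ha he hZ
      (hord _ _ hl₁) h
  · -- exchange the roles of `x` and `y`, replacing `z` by its inverse
    have hinv : ∀ (A : V ≃ₗ[ℂ] V) (l : ℂˣ),
        (∀ v, ρ.toFun z (A v) = (l : ℂ) • A (ρ.toFun z v)) →
        ∀ v, (ρ.toFun z)⁻¹ (A v) = ((l⁻¹ : ℂˣ) : ℂ) • A ((ρ.toFun z)⁻¹ v) := by
      intro A l hA v
      apply (ρ.toFun z).injective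
      have h1 : ∀ w, ρ.toFun z ((ρ.toFun z)⁻¹ w) = w := (ρ.toFun z).apply_symm_apply
      rw [h1, map_smul, hA, h1, smul_smul, ← Units.val_mul, inv_mul_cancel, Units.val_one,
        one_smul]
    have hpinv : ∀ (T : V ≃ₗ[ℂ] V) (c : ℂˣ), (∀ v, T v = (c : ℂ) • v) →
        ∀ v, T⁻¹ v = ((c⁻¹ : ℂˣ) : ℂ) • v := by
      intro T c hT v
      apply T.injective
      rw [map_smul, hT v, smul_smul, ← Units.val_mul, inv_mul_cancel, Units.val_one, one_smul]
      exact T.apply_symm_apply v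
    refine pow_le_finrank_of_orderOf_dvd hp hodd (ρ.toFun y) (ρ.toFun x) (ρ.toFun z)⁻¹ s⁻¹ l₂⁻¹
      l₁⁻¹ b e⁻¹ (fun v => ?_) (hinv _ _ hl₂) (hinv _ _ hl₁) hb ?_ ?_ ?_ ?_
    · rw [hs, map_smul, smul_smul, ← Units.val_mul, inv_mul_cancel, Units.val_one, one_smul]
      exact ((ρ.toFun z).symm_apply_apply _).symm
    · rw [inv_pow]
      exact hpinv _ _ he
    · rintro ⟨c, hc⟩
      rw [inv_pow] at hc
      exact hZ ⟨c⁻¹, by simpa using hpinv _ _ hc⟩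
    · rw [inv_pow, hord _ _ hl₂, inv_one]
    · rwa [orderOf_inv, orderOf_inv]

end ProjRep

/-! ### Centre, order and powers in the Heisenberg group. -/

namespace Heisenberg

variable {n N : ℕ}

theorem mem_center_iff {R : Type*} [CommRing R] {g : Heisenberg n R} :
    g ∈ Subgroup.center (Heisenberg n R) ↔ g.a = 0 ∧ g.b = 0 := by
  rw [Subgroup.mem_center_iff]
  constructor
  · intro h
    constructor
    · ext i
      have := congrArg Heisenberg.c (h ⟨0, Pi.single i 1, 0⟩)
      simpa using this.symm
    · ext i
      have := congrArg Heisenberg.c (h ⟨Pi.single i 1, 0, 0⟩)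
      simpa using this
  · rintro ⟨ha, hb⟩ h
    ext <;> simp [ha, hb, add_comm]

theorem commutator_le_center (R : Type*) [CommRing R] :
    commutator (Heisenberg n R) ≤ Subgroup.center (Heisenberg n R) := by
  rw [commutator_def, Subgroup.commutator_le]
  intro g _ h _
  rw [mem_center_iff]
  constructor <;> simp [commutatorElement_def]

/-- The centre of the Heisenberg group over `R` is the additive group of `R`. -/
def centerEquiv (n : ℕ) (R : Type*) [CommRing R] :
    Multiplicative R ≃* Subgroup.center (Heisenberg n R) where
  toFun c := ⟨⟨0, 0, c.toAdd⟩, mem_center_iff.2 ⟨rfl, rfl⟩⟩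
  invFun g := Multiplicative.ofAdd g.1.c
  left_inv c := rfl
  right_inv g := by
    obtain ⟨h1, h2⟩ := mem_center_iff.1 g.2
    ext <;> simp [h1, h2]
  map_mul' c d := by ext <;> simp

/-- The Heisenberg group as a type of triples. -/
def equivProd (n : ℕ) (R : Type*) : Heisenberg n R ≃ (Fin n → R) × (Fin n → R) × R where
  toFun g := (g.a, g.b, g.c)
  invFun t := ⟨t.1, t.2.1, t.2.2⟩
  left_inv _ := rfl
  right_inv _ := rfl

instance [NeZero N] : Finite (Heisenberg n (ZMod N)) := Finite.of_equiv _ (equivProd n _).symm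

theorem card (n N : ℕ) [NeZero N] : Nat.card (Heisenberg n (ZMod N)) = N ^ (2 * n + 1) := by
  rw [Nat.card_congr (equivProd n _), Nat.card_eq_fintype_card]
  simp only [Fintype.card_prod, Fintype.card_fun, Fintype.card_fin, ZMod.card]
  ring

theorem card_center (n N : ℕ) :
    Nat.card (Subgroup.center (Heisenberg n (ZMod N))) = N := by
  rw [← Nat.card_congr (centerEquiv n (ZMod N)).toEquiv, Nat.card_congr Multiplicative.toAdd,
    Nat.card_zmod]

theorem isCyclic_center (n N : ℕ) : IsCyclic (Subgroup.center (Heisenberg n (ZMod N))) :=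
  isCyclic_of_surjective _ (centerEquiv n (ZMod N)).surjective

/-- The hypothesis kills the term `(m choose 2) (a ⬝ᵥ b)` of the general power; it holds for the
generators `x`, `y` and `z`. -/
theorem pow_eq {R : Type*} [CommRing R] (g : Heisenberg n R) (h : g.a ⬝ᵥ g.b = 0) (m : ℕ) :
    g ^ m = ⟨m • g.a, m • g.b, m • g.c⟩ := by
  induction m with
  | zero => ext <;> simp
  | succ m ih =>
    rw [pow_succ, ih]
    ext <;> simp [succ_nsmul, smul_dotProduct, h, -nsmul_eq_mul]

theorem pow_le_of_mem_faithfulProjDegrees {p k d : ℕ} (hp : p.Prime) (hodd : Odd p)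
    (hd : d ∈ faithfulProjDegrees (Heisenberg 1 (ZMod (p ^ k)))) : p ^ k ≤ d := by
  obtain ⟨hd0, ρ, hρ⟩ := hd
  cases k with
  | zero => simpa using Nat.succ_le_of_lt hd0
  | succ k =>
    have : NeZero d := ⟨hd0.ne'⟩
    have hpow : ∀ g : Heisenberg 1 (ZMod (p ^ (k + 1))), g.a ⬝ᵥ g.b = 0 →
        g ^ p ^ (k + 1) = 1 := fun g hg => by
      rw [pow_eq g hg]
      ext <;> simp [nsmul_eq_mul, -Nat.cast_pow]
    have h := hρ.pow_le_finrank hp hodd (k := k) (x := ⟨1, 0, 0⟩) (y := ⟨0, 1, 0⟩) (z := ⟨0, 0, 1⟩)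
      (by ext <;> simp [dotProduct]) (by ext <;> simp) (by ext <;> simp)
      (hpow _ (by simp)) (hpow _ (by simp)) (hpow _ (by simp)) (by
        rw [pow_eq _ (by simp)]
        intro h
        have h1 := congrArg Heisenberg.c h
        simp only [nsmul_eq_mul, mul_one, one_c] at h1
        rw [ZMod.natCast_eq_zero_iff] at h1
        exact absurd (Nat.le_of_dvd (pow_pos hp.pos k) h1)
          (not_le.2 (Nat.pow_lt_pow_right hp.one_lt k.lt_succ_self)))
    simpa using h

end Heisenberg

/-! ### The main theorem. -/

theorem mainTheorem6 (p : ℕ) (hp : p.Prime) (hodd : Odd p) :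
    (∀ (G : Type*) [Group G] [Finite G], IsPGroup p G →
      commutator G ≤ Subgroup.center G → IsCyclic (Subgroup.center G) →
        ((∃ d : ℕ, IsIrredProjEmbeddingDegree G d) →
          ∃ k : ℕ, Nonempty (G ≃* Heisenberg 1 (ZMod (p ^ k)))) ∧
        (∀ k : ℕ, Nonempty (G ≃* Heisenberg 1 (ZMod (p ^ k))) →
          IsIrredProjEmbeddingDegree G (p ^ k) ∧ IsProjEmbeddingDegree G (p ^ k))) ∧
    (∀ n k : ℕ, 1 < n → 1 ≤ k →
      (¬ ∃ d : ℕ, IsIrredProjEmbeddingDegree (Heisenberg n (ZMod (p ^ k))) d) ∧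
      ∃ t : ℕ, IsProjEmbeddingDegree (Heisenberg n (ZMod (p ^ k))) t ∧
        t ≤ p ^ (k * (n / 2)) + p ^ (k * ((n + 1) / 2))) := by
  have := Fact.mk hp
  have hNe : ∀ k, NeZero (p ^ k) := fun k => ⟨(pow_pos hp.pos k).ne'⟩
  refine ⟨fun G _ _ hG hcl hcyc => ⟨?_, ?_⟩, fun n k hn hk => ⟨?_, ?_⟩⟩
  · rintro ⟨d, ⟨-, ρ, hf, hi⟩, -⟩
    obtain ⟨k, hk⟩ := (hG.to_subgroup (Subgroup.center G)).exists_card_eq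
    refine ⟨k, ?_⟩
    rw [← hk]
    exact ProjRep.nonempty_mulEquiv_heisenberg hf hi hcl hcyc (hk ▸ hodd.pow)
  · rintro k ⟨e⟩
    obtain ⟨h0, ρ, hf, hi⟩ := mem_faithfulIrredProjDegrees_heisenberg (N := p ^ k) hodd.pow
    have hf' : (ρ.comap e.toMonoidHom).IsFaithful := hf.comap e.injective
    have hle : ∀ d ∈ faithfulProjDegrees G, p ^ k ≤ d := by
      rintro d ⟨hd, σ, hσ⟩
      exact Heisenberg.pow_le_of_mem_faithfulProjDegrees hp hodd
        ⟨hd, σ.comap e.symm.toMonoidHom, hσ.comap e.symm.injective⟩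
    exact ⟨⟨⟨h0, _, hf', hi.comap e.surjective⟩, fun d ⟨hd, σ, hσ, _⟩ => hle d ⟨hd, σ, hσ⟩⟩,
      ⟨h0, _, hf'⟩, hle⟩
  · rintro ⟨d, ⟨-, ρ, hf, hi⟩, -⟩
    obtain ⟨e⟩ := ProjRep.nonempty_mulEquiv_heisenberg hf hi
      (Heisenberg.commutator_le_center _) (Heisenberg.isCyclic_center _ _)
      (by rw [Heisenberg.card_center]; exact hodd.pow)
    rw [Heisenberg.card_center] at e
    have h1 := Nat.card_congr e.toEquiv
    rw [Heisenberg.card, Heisenberg.card] at h1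
    -- Comparing orders gives `2n + 1 = 3`; this needs `p ^ k > 1`, hence `k ≥ 1`.
    have h2 := Nat.pow_right_injective (a := p ^ k) (Nat.one_lt_pow (by omega) hp.one_lt) h1
    omega
  · have h := pow_add_pow_mem_faithfulProjDegrees (n / 2) ((n + 1) / 2) (p ^ k)
    rw [show n / 2 + (n + 1) / 2 = n by omega, ← pow_mul, ← pow_mul] at h
    exact ⟨sInf _, ⟨Nat.sInf_mem ⟨_, h⟩, fun _ => Nat.sInf_le⟩, Nat.sInf_le h⟩
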